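/- Let $M$ be a smooth manifold of dimension $2n+1$ with a global contact form $\theta$, $\mathcal C=\ker\theta$, and let $\omega=d\theta|_{\mathcal C}$. Let $Z$ be the Reeb field ($\theta(Z)=1$, $Z\lrcorner d\theta=0$). For $f\in C^\infty(M)$ let $Y_f$ be its Hamiltonian field, i.e. the vector field in $\mathcal C$ with $Y_f\lrcorner d\theta=df-df(Z)\,\theta$. Let $M^{(1)}$ be the set of pairs $(m,L)$ with $m\in M$ and $L\subset\mathcal C_m$ a Lagrangian ($n$-dimensional $\omega$-isotropic) plane. A Lagrangian submanifold is an embedded $n$-dimensional submanifold $\Sigma\subset M$ with $T\Sigma\subset\mathcal C$. It is a solution of a second order equation $\mathcal E\subset M^{(1)}$ if $(m,T_m\Sigma)\in\mathcal E$ for all $m\in\Sigma$, and a solution of the first order equation $f=c$ if $f|_\Sigma\equiv c$. A function $f\in C^\infty(M)$ is an intermediate integral of $\mathcal E$ if, for every $c\in\mathbb R$, every Lagrangian submanifold which solves $f=c$ solves $\mathcal E$. Let $\mathcal D\subset\mathcal C$ be a smooth distribution of rank $n$, let $\mathcal D^\perp\subset\mathcal C$ be its $\omega$-orthogonal complement,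 and let $$\mathcal E_{\mathcal D}=\{(m,L)\in M^{(1)} : L\cap\mathcal D_m\neq 0\}.$$ A function is a first integral of a distribution if its differential vanishes on it. Let $f\in C^\infty(M)$. If $f$ is an intermediate integral of $\mathcal E_{\mathcal D}$, then $(Y_f)_m\in\mathcal D_m$ or $(Y_f)_m\in\mathcal D_m^\perp$ for every $m\in M$. Suppose moreover that $Y_f$ has no zeros, i.e. that $df$ and $\theta$ are linearly independent at every point. Then the following are equivalent: 1. $f$ is an intermediate integral of $\mathcal E_{\mathcal D}$; 2. for every $m\in M$, $(Y_f)_m\in\mathcal D_m$ or $(Y_f)_m\in\mathcal D^\perp_m$; 3. for every $m\in M$, $df_m$ vanishes on $\mathcal D_m$ or on $\mathcal D_m^\perp$; 4. there is a dense set of points of $M$ each of which has an open neighbourhood on which $f$ is a first integral of $\mathcal D$ or on which $f$ is a first integral of $\mathcal D^\perp$. In particular, if $f$ is a first integral of $\mathcal D$ or of $\mathcal D^\perp$ on $M$, then $f$ is an intermediate integral of $\mathcal E_{\mathcal D}$. If in addition $M$ is connected and $(Y_f)_m\notin\mathcal D_m\cap\mathcal D_m^\perp$ for all $m$, then $f$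 is an intermediate integral of $\mathcal E_{\mathcal D}$ if and only if $Y_f$ is a section of $\mathcal D$ or a section of $\mathcal D^\perp$ (over all of $M$), and if and only if $f$ is a first integral of $\mathcal D$ or a first integral of $\mathcal D^\perp$ (over all of $M$). -/

import Mathlib

open scoped Manifold ContDiff Topology

/-- The model space `ℝ ^ d`. -/
abbrev Model (d : ℕ) : Type := EuclideanSpace ℝ (Fin d)

noncomputable section

namespace ContactGeometry

section Forms

variable {d : ℕ} {M : Type*} [TopologicalSpace M] [ChartedSpace (Model d) M]

/-- The cotangent spaces of `M`; a (not necessarily smooth) `1`-form is a section of this family. -/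
abbrev Covector (d : ℕ) {M : Type*} [TopologicalSpace M] [ChartedSpace (Model d) M] (m : M) :
    Type :=
  TangentSpace (𝓡 d) m →L[ℝ] ℝ

/-- The expression of a `1`-form in the preferred chart `φ` at `x₀`, i.e. the pullback of `θ`
under `φ⁻¹`, a `1`-form on (an open subset of) `ℝ ^ d`. -/
def chartForm (θ : ∀ m : M, Covector d m) (x₀ : M) : Model d → (Model d →L[ℝ] ℝ) := fun x =>
  (θ ((extChartAt (𝓡 d) x₀).symm x)).comp
    (mfderiv (𝓡 d) (𝓡 d) (extChartAt (𝓡 d) x₀).symm x)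

/-- A `1`-form is smooth when its expressions in all charts of the preferred atlas are smooth. -/
def IsSmoothForm (θ : ∀ m : M, Covector d m) : Prop :=
  ∀ x₀ : M, ContDiffOn ℝ ∞ (chartForm θ x₀) (extChartAt (𝓡 d) x₀).target

/-- The exterior derivative of a `1`-form at `m`,
`dθ (v, w) = (∂_v θ) (w) - (∂_w θ) (v)`, computed in the preferred chart at `m`
(whose differential at `m` is the canonical identification of the tangent space at `m`
with `ℝ ^ d`). -/
def extDer (θ : ∀ m : M, Covector d m) (m : M) :
    TangentSpace (𝓡 d) m →L[ℝ] TangentSpace (𝓡 d) m →L[ℝ] ℝ :=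
  let A : Model d →L[ℝ] Model d →L[ℝ] ℝ :=
    fderiv ℝ (chartForm θ m) (extChartAt (𝓡 d) m m)
  A - A.flip

theorem extDer_swap (θ : ∀ m : M, Covector d m) (m : M) (v w : TangentSpace (𝓡 d) m) :
    extDer θ m v w = -extDer θ m w v :=
  (neg_sub _ _).symm

/-- The hyperplane `𝒞_m = ker θ_m`. -/
def contactPlane (θ : ∀ m : M, Covector d m) (m : M) : Submodule ℝ (TangentSpace (𝓡 d) m) :=
  LinearMap.ker (θ m).toLinearMap

/-- A smooth distribution of rank `k`: a field of `k`-dimensional tangent subspaces which is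
locally spanned by `k` smooth, pointwise linearly independent vector fields. -/
def IsDistribution [IsManifold (𝓡 d) ∞ M] (k : ℕ)
    (D : ∀ m : M, Submodule ℝ (TangentSpace (𝓡 d) m)) : Prop :=
  ∀ m₀ : M, ∃ U : Set M, IsOpen U ∧ m₀ ∈ U ∧
    ∃ X : Fin k → ∀ m : M, TangentSpace (𝓡 d) m,
      (∀ i, ContMDiffOn (𝓡 d) (𝓡 d).tangent ∞
        (fun m => (⟨m, X i m⟩ : TangentBundle (𝓡 d) M)) U) ∧
      ∀ m ∈ U, LinearIndependent ℝ (fun i => X i m) ∧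
        D m = Submodule.span ℝ (Set.range fun i => X i m)

/-- `f` is a first integral of `D`: it is annihilated by all vectors of `D`. -/
def IsFirstIntegral (D : ∀ m : M, Submodule ℝ (TangentSpace (𝓡 d) m)) (f : M → ℝ) : Prop :=
  ∀ m : M, ∀ v ∈ D m, mvfderiv (𝓡 d) f m v = 0

/-- `j`, restricted to the open set `W ⊆ ℝ ^ k`, is a smooth parametrization of a relatively open
piece of `S`: an immersion and a homeomorphism onto its image, which is relatively open in `S`. -/
structure IsLocalParametrization (d : ℕ) {M : Type*} [TopologicalSpace M]
    [ChartedSpace (Model d) M] {k : ℕ} (S : Set M) (W : Set (Model k)) (j : Model k → M) :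
    Prop where
  isOpen : IsOpen W
  contMDiffOn : ContMDiffOn (𝓡 k) (𝓡 d) ∞ j W
  immersion : ∀ x ∈ W, Function.Injective (mfderiv (𝓡 k) (𝓡 d) j x)
  isEmbedding : Topology.IsEmbedding (W.domRestrict j)
  image_eq : ∃ O : Set M, IsOpen O ∧ j '' W = S ∩ O

/-- `S` is a (smooth, embedded) `k`-dimensional submanifold of `M`. -/
def IsSubmanifold (d : ℕ) {M : Type*} [TopologicalSpace M] [ChartedSpace (Model d) M]
    (k : ℕ) (S : Set M) : Prop :=
  ∀ p ∈ S, ∃ (W : Set (Model k)) (j : Model k → M), IsLocalParametrization d S W j ∧ p ∈ j '' W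

/-- The set of all tangent spaces `(p, T_p S)` of a `k`-dimensional submanifold `S`. -/
def tangentPlanes (d : ℕ) {M : Type*} [TopologicalSpace M] [ChartedSpace (Model d) M]
    (k : ℕ) (S : Set M) :
    Set (Σ m : M, Submodule ℝ (TangentSpace (𝓡 d) m)) :=
  {P | ∃ (W : Set (Model k)) (j : Model k → M), IsLocalParametrization d S W j ∧
    ∃ x ∈ W, P = ⟨j x, LinearMap.range (mfderiv (𝓡 k) (𝓡 d) j x).toLinearMap⟩}

end Forms

section Contact

variable {n : ℕ} {M : Type*} [TopologicalSpace M] [ChartedSpace (Model (2 * n + 1)) M]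

/-- `θ` is a contact form on the `(2n+1)`-dimensional manifold `M`: it is smooth, nowhere zero, and
`dθ` is nondegenerate on `𝒞 = ker θ`. -/
structure IsContactForm (θ : ∀ m : M, Covector (2 * n + 1) m) : Prop where
  smooth : IsSmoothForm θ
  ne_zero : ∀ m, θ m ≠ 0
  nondegenerate : ∀ m, ∀ v ∈ contactPlane θ m,
    (∀ w ∈ contactPlane θ m, extDer θ m v w = 0) → v = 0

/-- The defining property of the Reeb vector at `m`: `θ(Z) = 1` and `Z ⌟ dθ = 0`. -/
def IsReebAt (θ : ∀ m : M, Covector (2 * n + 1) m) (m : M)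
    (Z : TangentSpace (𝓡 (2 * n + 1)) m) : Prop :=
  θ m Z = 1 ∧ ∀ v, extDer θ m Z v = 0

/-- The Reeb vector field `Z` of a contact form. -/
def reeb (θ : ∀ m : M, Covector (2 * n + 1) m) (m : M) : TangentSpace (𝓡 (2 * n + 1)) m :=
  haveI : Nonempty (TangentSpace (𝓡 (2 * n + 1)) m) := ⟨0⟩
  Classical.epsilon (IsReebAt θ m)

/-- The defining property of the Hamiltonian vector of `f` at `m`: `Y ∈ 𝒞_m` and
`Y ⌟ dθ = df - df(Z) θ`. -/
def IsHamiltonianAt (θ : ∀ m : M, Covector (2 * n + 1) m) (f : M → ℝ) (m : M)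
    (Y : TangentSpace (𝓡 (2 * n + 1)) m) : Prop :=
  Y ∈ contactPlane θ m ∧
    ∀ v, extDer θ m Y v = mvfderiv (𝓡 (2 * n + 1)) f m v
      - mvfderiv (𝓡 (2 * n + 1)) f m (reeb θ m) * θ m v

/-- The Hamiltonian vector field `Y_f`. -/
def hamiltonianField (θ : ∀ m : M, Covector (2 * n + 1) m) (f : M → ℝ) (m : M) :
    TangentSpace (𝓡 (2 * n + 1)) m :=
  haveI : Nonempty (TangentSpace (𝓡 (2 * n + 1)) m) := ⟨0⟩
  Classical.epsilon (IsHamiltonianAt θ f m)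

/-- Nondegeneracy of `dθ` on `𝒞_m`: functionals on `𝒞_m` are represented by vectors of `𝒞_m`. -/
theorem IsContactForm.exists_represent {θ : ∀ m : M, Covector (2 * n + 1) m}
    (h : IsContactForm θ) (m : M) (α : TangentSpace (𝓡 (2 * n + 1)) m →ₗ[ℝ] ℝ) :
    ∃ y ∈ contactPlane θ m, ∀ w ∈ contactPlane θ m, extDer θ m y w = α w := by
  have : FiniteDimensional ℝ (TangentSpace (𝓡 (2 * n + 1)) m) :=
    inferInstanceAs (FiniteDimensional ℝ (Model (2 * n + 1)))
  let Ω : TangentSpace (𝓡 (2 * n + 1)) m →ₗ[ℝ] TangentSpace (𝓡 (2 * n + 1)) m →ₗ[ℝ] ℝ :=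
    LinearMap.mk₂ ℝ (fun v w => extDer θ m v w)
      (fun a b c => by simp) (fun a b c => by simp) (fun a b c => by simp) (fun a b c => by simp)
  let B : contactPlane θ m →ₗ[ℝ] Module.Dual ℝ (contactPlane θ m) :=
    Ω.domRestrict₁₂ (contactPlane θ m) (contactPlane θ m)
  have hB : Function.Injective B := by
    rw [← LinearMap.ker_eq_bot, LinearMap.ker_eq_bot']
    intro v hv
    apply Subtype.ext
    exact h.nondegenerate m v v.2 fun w hw => LinearMap.congr_fun hv ⟨w, hw⟩
  have hs : Function.Surjective B :=
    (LinearMap.injective_iff_surjective_of_finrank_eq_finrank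
      (Subspace.dual_finrank_eq (K := ℝ) (V := contactPlane θ m)).symm).1 hB
  obtain ⟨y, hy⟩ := hs (α.domRestrict (contactPlane θ m))
  exact ⟨y, y.2, fun w hw => LinearMap.congr_fun hy ⟨w, hw⟩⟩

theorem extDer_self (θ : ∀ m : M, Covector (2 * n + 1) m) (m : M)
    (v : TangentSpace (𝓡 (2 * n + 1)) m) : extDer θ m v v = 0 := by
  have := extDer_swap θ m v v
  linarith

theorem IsContactForm.isReebAt_reeb {θ : ∀ m : M, Covector (2 * n + 1) m}
    (h : IsContactForm θ) (m : M) : IsReebAt θ m (reeb θ m) := by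
  refine Classical.epsilon_spec (p := IsReebAt θ m) ?_
  obtain ⟨u, hu⟩ : ∃ u, θ m u ≠ 0 := by
    by_contra hc
    push Not at hc
    exact h.ne_zero m (ContinuousLinearMap.ext hc)
  obtain ⟨y, hy, hyw⟩ := h.exists_represent m (extDer θ m ((θ m u)⁻¹ • u)).toLinearMap
  have hy0 : θ m y = 0 := hy
  have h1 : θ m ((θ m u)⁻¹ • u - y) = 1 := by
    rw [map_sub, map_smul, hy0, smul_eq_mul, inv_mul_cancel₀ hu, sub_zero]
  refine ⟨(θ m u)⁻¹ • u - y, h1, fun v => ?_⟩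
  set Z := (θ m u)⁻¹ • u - y with hZ
  have hv : v - θ m v • Z ∈ contactPlane θ m := by
    change θ m (v - θ m v • Z) = 0
    rw [map_sub, map_smul, h1]; simp
  have h2 : extDer θ m Z (v - θ m v • Z) = 0 := by
    have := hyw _ hv
    have h3 : extDer θ m Z = extDer θ m ((θ m u)⁻¹ • u) - extDer θ m y := map_sub _ _ _
    rw [h3]
    exact sub_eq_zero.2 this.symm
  rw [map_sub, map_smul, extDer_self] at h2
  simpa using h2

theorem IsContactForm.isHamiltonianAt {θ : ∀ m : M, Covector (2 * n + 1) m}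
    (h : IsContactForm θ) (f : M → ℝ) (m : M) :
    IsHamiltonianAt θ f m (hamiltonianField θ f m) := by
  refine Classical.epsilon_spec (p := IsHamiltonianAt θ f m) ?_
  obtain ⟨y, hy, hyw⟩ := h.exists_represent m (mvfderiv (𝓡 (2 * n + 1)) f m).toLinearMap
  obtain ⟨h1, h2⟩ := h.isReebAt_reeb m
  refine ⟨y, hy, fun v => ?_⟩
  have hv : v - θ m v • reeb θ m ∈ contactPlane θ m := by
    change θ m (v - θ m v • reeb θ m) = 0
    rw [map_sub, map_smul, h1]; simp
  have h3 : extDer θ m y (v - θ m v • reeb θ m)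
      = mvfderiv (𝓡 (2 * n + 1)) f m (v - θ m v • reeb θ m) := hyw _ hv
  rw [map_sub, map_sub, map_smul, map_smul, extDer_swap θ m y (reeb θ m), h2] at h3
  simp only [smul_eq_mul, neg_zero, mul_zero, sub_zero] at h3
  rw [h3]; ring

theorem IsContactForm.isHamiltonianAt_iff {θ : ∀ m : M, Covector (2 * n + 1) m}
    (h : IsContactForm θ) (f : M → ℝ) (m : M) (Y : TangentSpace (𝓡 (2 * n + 1)) m) :
    IsHamiltonianAt θ f m Y ↔ Y = hamiltonianField θ f m := by
  refine ⟨fun hY => ?_, fun hY => hY ▸ h.isHamiltonianAt f m⟩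
  have hH := h.isHamiltonianAt f m
  refine sub_eq_zero.1 (h.nondegenerate m _ (Submodule.sub_mem _ hY.1 hH.1) fun w _ => ?_)
  rw [map_sub]
  exact sub_eq_zero.2 ((hY.2 w).trans (hH.2 w).symm)

/-- The `ω`-orthogonal complement in `𝒞` of a subdistribution, where `ω = dθ|_𝒞`. -/
def orth (θ : ∀ m : M, Covector (2 * n + 1) m)
    (D : ∀ m : M, Submodule ℝ (TangentSpace (𝓡 (2 * n + 1)) m)) (m : M) :
    Submodule ℝ (TangentSpace (𝓡 (2 * n + 1)) m) where
  carrier := {v | v ∈ contactPlane θ m ∧ ∀ w ∈ D m, extDer θ m w v = 0}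
  add_mem' := fun {a b} ha hb => ⟨Submodule.add_mem _ ha.1 hb.1, fun w hw => by
    rw [map_add, ha.2 w hw, hb.2 w hw, add_zero]⟩
  zero_mem' := ⟨Submodule.zero_mem _, fun w _ => map_zero _⟩
  smul_mem' := fun c a ha => ⟨Submodule.smul_mem _ c ha.1, fun w hw => by
    rw [map_smul, ha.2 w hw, smul_zero]⟩

/-- The prolongation `M⁽¹⁾`: all pairs `(m, L)` with `L` a Lagrangian plane of `(𝒞_m, dθ)`. -/
def prolongation (θ : ∀ m : M, Covector (2 * n + 1) m) :
    Set (Σ m : M, Submodule ℝ (TangentSpace (𝓡 (2 * n + 1)) m)) :=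
  {P | P.2 ≤ contactPlane θ P.1 ∧ Module.finrank ℝ P.2 = n ∧
    ∀ v ∈ P.2, ∀ w ∈ P.2, extDer θ P.1 v w = 0}

/-- The Goursat-type Monge-Ampère equation `ℰ_𝒟 ⊆ M⁽¹⁾`: the Lagrangian planes which meet `𝒟`
non-trivially. -/
def goursatEquation (θ : ∀ m : M, Covector (2 * n + 1) m)
    (D : ∀ m : M, Submodule ℝ (TangentSpace (𝓡 (2 * n + 1)) m)) :
    Set (Σ m : M, Submodule ℝ (TangentSpace (𝓡 (2 * n + 1)) m)) :=
  {P | P ∈ prolongation θ ∧ P.2 ⊓ D P.1 ≠ ⊥}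

/-- A Lagrangian submanifold: an `n`-dimensional integral submanifold of `𝒞`. -/
def IsLagrangianSubmanifold (θ : ∀ m : M, Covector (2 * n + 1) m) (S : Set M) : Prop :=
  IsSubmanifold (2 * n + 1) n S ∧ ∀ P ∈ tangentPlanes (2 * n + 1) n S, P.2 ≤ contactPlane θ P.1

/-- The (`n`-dimensional) solutions of the first order PDE `M_g = {g = 0}`. -/
def IsSolutionOfFirstOrder (θ : ∀ m : M, Covector (2 * n + 1) m) (g : M → ℝ) (S : Set M) :
    Prop :=
  IsLagrangianSubmanifold θ S ∧ ∀ m ∈ S, g m = 0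

/-- The solutions of a second order PDE `E ⊆ M⁽¹⁾`: Lagrangian submanifolds all of whose tangent
planes belong to `E`. -/
def IsSolution (θ : ∀ m : M, Covector (2 * n + 1) m)
    (E : Set (Σ m : M, Submodule ℝ (TangentSpace (𝓡 (2 * n + 1)) m))) (S : Set M) : Prop :=
  IsLagrangianSubmanifold θ S ∧ tangentPlanes (2 * n + 1) n S ⊆ E

/-- `f` is an intermediate integral of `E`: for every `c`, all solutions of the first order PDE
`f - c = 0` are solutions of `E`. -/
def IsIntermediateIntegral (θ : ∀ m : M, Covector (2 * n + 1) m)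
    (E : Set (Σ m : M, Submodule ℝ (TangentSpace (𝓡 (2 * n + 1)) m))) (f : M → ℝ) : Prop :=
  ∀ c : ℝ, ∀ S : Set M, IsSolutionOfFirstOrder θ (fun m => f m - c) S → IsSolution θ E S

end Contact

end ContactGeometry

end

open ContactGeometry

/-! On `𝒞` the form `dθ(Y_f, ·)` equals `df`. If a Lagrangian submanifold lies in a level set of
`f`, then `df` vanishes on its tangent plane `L`, so `Y_f` is orthogonal to `L`, and `Y_f ∈ L`
because a Lagrangian plane is its own orthogonal complement. If the nonzero vector `Y_f` is in `D`,
then `L` meets `D`. If it is in `D^⊥`, then `L` meets `D` as well, since `L ∩ D = 0` would give `L +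
D = 𝒞` and hence `L ∩ D^⊥ = (L + D)^⊥ = 0`. This is
`isIntermediateIntegral_of_hamiltonianField_mem`.

For the converse, suppose `Y_f` is in neither `D` nor `D^⊥` at `m`; in particular it is nonzero
there. A dimension count (`exists_lagrangian_transversal`) gives a Lagrangian plane `L` through
`Y_f` with `L ∩ D = 0`. It remains to realise `L` as the tangent plane of a Lagrangian submanifold
inside `f = f(m)`, which is then a solution of `f = c` violating `ℰ_D` at `m`. This existence
statement is the analytic core (`exists_integralGerm_levelSet_of_slice`). A slice of the level set
transversal to `Y_f` is again contact. Induction on `dim L` gives an integral manifold of the slice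
tangent to the trace of `L`, and the flow of `Y_f` sweeps it out. By Cartan's formula the pullback
of `θ` satisfies a homogeneous linear equation along the flow, so it stays zero. The induction needs
no level set: without one, the linear function `dθ(Y₀, ·)` serves as `f`. The smooth flow comes from
the inverse function theorem on curves.

The other characterisations follow from the pointwise one. `Y_f ∈ D^⊥` means `df|_D = 0`, and `Y_f ∈
D` means `df|_{D^⊥} = 0` by double orthogonality. Both conditions are closed in `m`, which yields
the dense local form and, when they exclude each other on a connected `M`, the global form. -/

namespace ContactGeometry
open Filter

/-! ### Exterior derivative, smooth germs and local inverses on normed spaces -/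

section Calculus

variable {E F G : Type*} [NormedAddCommGroup E] [NormedSpace ℝ E]
  [NormedAddCommGroup F] [NormedSpace ℝ F] [NormedAddCommGroup G] [NormedSpace ℝ G]

/-- The exterior derivative of a `1`-form on a normed space. -/
noncomputable def extDerivForm (θ : E → E →L[ℝ] ℝ) (x : E) : E →L[ℝ] E →L[ℝ] ℝ :=
  fderiv ℝ θ x - (fderiv ℝ θ x).flip

theorem extDerivForm_apply (θ : E → E →L[ℝ] ℝ) (x v w : E) :
    extDerivForm θ x v w = fderiv ℝ θ x v w - fderiv ℝ θ x w v := rfl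

theorem extDerivForm_self (θ : E → E →L[ℝ] ℝ) (x v : E) : extDerivForm θ x v v = 0 := by
  simp [extDerivForm_apply]

theorem extDerivForm_swap (θ : E → E →L[ℝ] ℝ) (x v w : E) :
    extDerivForm θ x v w = -extDerivForm θ x w v := by
  simp [extDerivForm_apply]

theorem extDerivForm_congr {θ θ' : E → E →L[ℝ] ℝ} {x : E} (h : θ =ᶠ[𝓝 x] θ') :
    extDerivForm θ x = extDerivForm θ' x := by
  simp [extDerivForm, h.fderiv_eq]

/-- The pullback of a `1`-form. -/
noncomputable def pullbackForm (ψ : F → E) (θ : E → E →L[ℝ] ℝ) (y : F) : F →L[ℝ] ℝ :=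
  (θ (ψ y)).comp (fderiv ℝ ψ y)

theorem pullbackForm_apply (ψ : F → E) (θ : E → E →L[ℝ] ℝ) (y v : F) :
    pullbackForm ψ θ y v = θ (ψ y) (fderiv ℝ ψ y v) := rfl

theorem contDiff_pullbackForm {ψ : F → E} {θ : E → E →L[ℝ] ℝ} (hψ : ContDiff ℝ ∞ ψ)
    (hθ : ContDiff ℝ ∞ θ) : ContDiff ℝ ∞ (pullbackForm ψ θ) :=
  (hθ.comp hψ).clm_comp (hψ.fderiv_right (m := ∞) (by simp))

/-- Naturality of the exterior derivative. -/
theorem extDerivForm_pullbackForm {ψ : F → E} {θ : E → E →L[ℝ] ℝ} {y : F}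
    (hψ : ContDiffAt ℝ ∞ ψ y) (hθ : DifferentiableAt ℝ θ (ψ y)) (v w : F) :
    extDerivForm (pullbackForm ψ θ) y v w =
      extDerivForm θ (ψ y) (fderiv ℝ ψ y v) (fderiv ℝ ψ y w) := by
  have h1 : HasFDerivAt ψ (fderiv ℝ ψ y) y := (hψ.differentiableAt (by simp)).hasFDerivAt
  have h2 : HasFDerivAt (fderiv ℝ ψ) (fderiv ℝ (fderiv ℝ ψ) y) y :=
    ((hψ.fderiv_right (m := ∞) (by simp)).differentiableAt (by simp)).hasFDerivAt
  have h3 := (hθ.hasFDerivAt.comp y h1).clm_comp h2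
  -- The terms `θ (D²ψ v w)` cancel under antisymmetrisation by symmetry of the second derivative.
  have hs : IsSymmSndFDerivAt ℝ ψ y := hψ.isSymmSndFDerivAt (by
    rw [minSmoothness_of_isRCLikeNormedField]; exact WithTop.coe_le_coe.2 le_top)
  have h4 : fderiv ℝ (pullbackForm ψ θ) y = _ := h3.fderiv
  simp only [extDerivForm_apply, h4]
  simp [hs v w]

/-- Germs of smooth maps extend to smooth maps. -/
theorem exists_contDiff_eventuallyEq [FiniteDimensional ℝ E] {g : E → F} {a : E}
    (hg : ∀ᶠ x in 𝓝 a, ContDiffAt ℝ ∞ g x) : ∃ G : E → F, ContDiff ℝ ∞ G ∧ G =ᶠ[𝓝 a] g := by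
  obtain ⟨r, hr, h⟩ := Metric.eventually_nhds_iff_ball.1 hg
  let b : ContDiffBump a := ⟨r / 3, r / 2, by positivity, by linarith⟩
  refine ⟨fun x => b x • g x, ?_, ?_⟩
  · rw [contDiff_iff_contDiffAt]
    intro x
    by_cases hx : x ∈ Metric.ball a r
    · exact b.contDiffAt.smul (h x hx)
    · have hx' : x ∈ (Metric.closedBall a b.rOut)ᶜ := by
        simp only [Set.mem_compl_iff, Metric.mem_closedBall, Metric.mem_ball, not_le, not_lt,
          b] at hx ⊢
        linarith
      have : (fun x => b x • g x) =ᶠ[𝓝 x] fun _ => 0 := by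
        filter_upwards [Metric.isClosed_closedBall.isOpen_compl.mem_nhds hx'] with z hz
        rw [b.zero_of_le_dist (by simpa using (le_of_lt (by simpa using hz))), zero_smul]
      exact contDiffAt_const.congr_of_eventuallyEq this
  · filter_upwards [b.eventuallyEq_one] with x hx
    simp [hx]

/-- The inverse function theorem for smooth maps: a local inverse which is smooth near the point. -/
theorem exists_smooth_localInverse [CompleteSpace E] {φ : E → F} {a : E} (hφ : ContDiff ℝ ∞ φ)
    (e : E ≃L[ℝ] F) (he : HasFDerivAt φ (e : E →L[ℝ] F) a) :
    ∃ g : F → E, g (φ a) = a ∧ HasFDerivAt g (e.symm : F →L[ℝ] E) (φ a) ∧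
      (∀ᶠ y in 𝓝 (φ a), ContDiffAt ℝ ∞ g y) ∧ (∀ᶠ y in 𝓝 (φ a), φ (g y) = y) ∧
      ∀ᶠ x in 𝓝 a, g (φ x) = x := by
  let P := hφ.contDiffAt.toOpenPartialHomeomorph φ he (n := ∞) (by simp)
  have hP : (P : E → F) = φ := rfl
  have ha : a ∈ P.source := hφ.contDiffAt.mem_toOpenPartialHomeomorph_source he (by simp)
  have hPa : P.symm (φ a) = a := P.left_inv ha
  have hfa : φ a ∈ P.target := P.map_source ha
  refine ⟨P.symm, hPa, ?_, ?_, ?_, ?_⟩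
  · exact P.hasFDerivAt_symm hfa (by rw [hPa]; exact he)
  -- Smoothness of the inverse at a nearby point requires an invertible derivative there;
  -- invertibility is an open condition.
  · have hopen : ∀ᶠ y in 𝓝 (φ a), ∃ e' : E ≃L[ℝ] F, (e' : E →L[ℝ] F) = fderiv ℝ φ (P.symm y) := by
      have hc : ContinuousAt (fun y => fderiv ℝ φ (P.symm y)) (φ a) :=
        (hφ.continuous_fderiv (by simp)).continuousAt.comp (P.continuousAt_symm hfa)
      have hn : Set.range ((↑) : (E ≃L[ℝ] F) → E →L[ℝ] F) ∈ 𝓝 (fderiv ℝ φ (P.symm (φ a))) := by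
        rw [hPa, he.fderiv]
        exact e.nhds
      exact hc hn
    filter_upwards [hopen, P.open_target.mem_nhds hfa] with y ⟨e', he'⟩ hy
    refine P.contDiffAt_symm (f₀' := e') hy ?_ hφ.contDiffAt
    rw [he']
    exact (hφ.contDiffAt.differentiableAt (by simp)).hasFDerivAt
  · filter_upwards [P.open_target.mem_nhds hfa] with y hy using P.right_inv hy
  · filter_upwards [P.open_source.mem_nhds ha] with y hy using P.left_inv hy

end Calculus

end ContactGeometry

namespace ContactGeometry
open Filter

/-! ### Superposition operators on spaces of continuous maps -/

section Superposition

universe u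
variable {X : Type*} [TopologicalSpace X] [CompactSpace X]
  {E F : Type*} [NormedAddCommGroup E] [NormedSpace ℝ E] [NormedAddCommGroup F] [NormedSpace ℝ F]

/-- Pointwise application of a continuous family of linear maps to a continuous map. -/
noncomputable def pointwiseApply (X : Type*) [TopologicalSpace X] [CompactSpace X]
    (E F : Type*) [NormedAddCommGroup E] [NormedSpace ℝ E]
    [NormedAddCommGroup F] [NormedSpace ℝ F] :
    C(X, E →L[ℝ] F) →L[ℝ] C(X, E) →L[ℝ] C(X, F) :=
  LinearMap.mkContinuous₂ (E := C(X, E →L[ℝ] F)) (F := C(X, E)) (G := C(X, F))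
    (LinearMap.mk₂ ℝ (fun A h => ⟨fun t => A t (h t), by fun_prop⟩)
      (fun a b c => by ext; simp) (fun a b c => by ext; simp)
      (fun a b c => by ext; simp) (fun a b c => by ext; simp)) 1
    (fun A h => by
      rw [ContinuousMap.norm_le _ (by positivity), one_mul]
      intro t
      exact ((A t).le_opNorm _).trans
        (mul_le_mul (A.norm_coe_le_norm t) (h.norm_coe_le_norm t) (by positivity) (by positivity)))

@[simp] theorem pointwiseApply_apply (A : C(X, E →L[ℝ] F)) (h : C(X, E)) (t : X) :
    pointwiseApply X E F A h t = A t (h t) := rfl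

/-- The derivative of the superposition operator `γ ↦ V ∘ γ`. -/
theorem hasFDerivAt_postcomp {V : E → F} (hV : ContDiff ℝ 1 V) (γ : C(X, E)) :
    HasFDerivAt (fun γ : C(X, E) => (⟨V, hV.continuous⟩ : C(E, F)).comp γ)
      (pointwiseApply X E F ((⟨fderiv ℝ V, hV.continuous_fderiv (by simp)⟩ :
        C(E, E →L[ℝ] F)).comp γ)) γ := by
  rw [hasFDerivAt_iff_isLittleO_nhds_zero, Asymptotics.isLittleO_iff]
  intro c hc
  have hcont : Continuous fun η : C(X, E) => (⟨fderiv ℝ V, hV.continuous_fderiv (by simp)⟩ :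
      C(E, E →L[ℝ] F)).comp η := ContinuousMap.continuous_postcomp _
  obtain ⟨δ, hδ, h⟩ := Metric.continuousAt_iff (α := C(X, E)) (β := C(X, E →L[ℝ] F)) |>.1
    (hcont.continuousAt (x := γ)) c hc
  filter_upwards [Metric.ball_mem_nhds (0 : C(X, E)) hδ] with η hη
  rw [mem_ball_zero_iff] at hη
  rw [ContinuousMap.norm_le _ (by positivity)]
  intro t
  -- Mean value inequality on the segment from `γ t` to `γ t + η t`. The bound `c` is uniform in `t`
  -- because composition with `fderiv ℝ V` is continuous in the sup norm.
  have key : ‖V (γ t + η t) - V (γ t) - fderiv ℝ V (γ t) (γ t + η t - γ t)‖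
      ≤ c * ‖γ t + η t - γ t‖ := by
    refine (convex_segment (γ t) (γ t + η t)).norm_image_sub_le_of_norm_hasFDerivWithin_le'
      (f' := fderiv ℝ V) (fun x _ => (hV.differentiable (by simp) x).hasFDerivAt.hasFDerivWithinAt)
      (fun x hx => ?_) (left_mem_segment _ _ _) (right_mem_segment _ _ _)
    rw [segment_eq_image'] at hx
    obtain ⟨s, hs, rfl⟩ := hx
    have h1 : dist (γ + s • η) γ < δ := by
      rw [dist_eq_norm, add_sub_cancel_left, norm_smul, Real.norm_of_nonneg hs.1]
      exact (mul_le_of_le_one_left (norm_nonneg _) hs.2).trans_lt hη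
    have h2 := (ContinuousMap.dist_apply_le_dist t).trans (h h1).le
    simpa [dist_eq_norm] using h2
  have h3 : ‖η t‖ ≤ ‖η‖ := η.norm_coe_le_norm t
  simp only [add_sub_cancel_left] at key
  refine le_trans ?_ (key.trans (mul_le_mul_of_nonneg_left h3 hc.le))
  simp

/-- The derivative is again a superposition operator, that of `fderiv ℝ V`, followed by a continuous
linear map. The induction therefore changes the target to `E →L[ℝ] F`, so `F` is quantified inside
it and shares the universe of `E`. -/
theorem contDiff_postcomp_nat {X : Type*} [TopologicalSpace X] [CompactSpace X]
    {E : Type u} [NormedAddCommGroup E] [NormedSpace ℝ E] (n : ℕ) :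
    ∀ {F : Type u} [NormedAddCommGroup F] [NormedSpace ℝ F] {V : E → F} (hV : ContDiff ℝ n V),
      ContDiff ℝ n (fun γ : C(X, E) => (⟨V, hV.continuous⟩ : C(E, F)).comp γ) := by
  induction n with
  | zero =>
    intro F _ _ V hV
    simp only [Nat.cast_zero, contDiff_zero]
    exact ContinuousMap.continuous_postcomp _
  | succ n ih =>
    intro F _ _ V hV
    have h1 : ContDiff ℝ 1 V := hV.of_le (by norm_cast; omega)
    have h2 : ContDiff ℝ n (fderiv ℝ V) := hV.fderiv_right (by norm_cast)
    refine (contDiff_succ_iff_fderiv (n := n)).2 ?_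
    refine ⟨fun γ => (hasFDerivAt_postcomp h1 γ).differentiableAt, by simp, ?_⟩
    have : fderiv ℝ (fun γ : C(X, E) => (⟨V, hV.continuous⟩ : C(E, F)).comp γ) =
        fun γ => pointwiseApply X E F ((⟨fderiv ℝ V, h2.continuous⟩ :
          C(E, E →L[ℝ] F)).comp γ) := funext fun γ => (hasFDerivAt_postcomp h1 γ).fderiv
    rw [this]
    exact (pointwiseApply X E F).contDiff.comp (ih h2)

/-- The superposition operator of a smooth map is smooth. -/
theorem contDiff_postcomp {X : Type*} [TopologicalSpace X] [CompactSpace X]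
    {E F : Type u} [NormedAddCommGroup E] [NormedSpace ℝ E] [NormedAddCommGroup F]
    [NormedSpace ℝ F] {V : E → F} (hV : ContDiff ℝ ∞ V) :
    ContDiff ℝ ∞ (fun γ : C(X, E) => (⟨V, hV.continuous⟩ : C(E, F)).comp γ) :=
  contDiff_infty.2 fun n => contDiff_postcomp_nat n (contDiff_infty.1 hV n)

end Superposition

/-! ### Smooth local flows from the inverse function theorem -/

section Flow

universe u
variable {E : Type u} [NormedAddCommGroup E] [NormedSpace ℝ E] [CompleteSpace E]

open unitInterval in
/-- The primitive vanishing at `0` of a continuous map on the unit interval. -/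
noncomputable def primitive (E : Type*) [NormedAddCommGroup E] [NormedSpace ℝ E]
    [CompleteSpace E] : C(I, E) →L[ℝ] C(I, E) :=
  LinearMap.mkContinuous
    { toFun := fun γ => ⟨fun t => ∫ τ in (0 : ℝ)..t, γ (Set.projIcc 0 1 zero_le_one τ), by
        have : Continuous fun τ : ℝ => γ (Set.projIcc 0 1 zero_le_one τ) :=
          γ.continuous.comp continuous_projIcc
        exact (intervalIntegral.continuous_primitive
          (fun a b => this.intervalIntegrable a b) 0).comp continuous_subtype_val⟩
      map_add' := fun a b => by
        ext t
        have ha : Continuous fun τ : ℝ => a (Set.projIcc 0 1 zero_le_one τ) :=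
          a.continuous.comp continuous_projIcc
        have hb : Continuous fun τ : ℝ => b (Set.projIcc 0 1 zero_le_one τ) :=
          b.continuous.comp continuous_projIcc
        exact intervalIntegral.integral_add (ha.intervalIntegrable _ _) (hb.intervalIntegrable _ _)
      map_smul' := fun c a => by
        ext t
        exact intervalIntegral.integral_smul c _ } 1
    (fun γ => by
      rw [ContinuousMap.norm_le _ (by positivity), one_mul]
      intro t
      have h := intervalIntegral.norm_integral_le_of_norm_le_const (a := (0 : ℝ)) (b := t)
        (f := fun τ => γ (Set.projIcc 0 1 zero_le_one τ)) (C := ‖γ‖)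
        (fun x _ => γ.norm_coe_le_norm _)
      refine h.trans ?_
      rw [sub_zero, abs_of_nonneg t.2.1]
      exact mul_le_of_le_one_right (norm_nonneg _) t.2.2)

open unitInterval in
/-- Smooth vector fields have smooth local flows (integral form). -/
theorem exists_smooth_integral_flow {V : E → E} (hV : ContDiff ℝ ∞ V) :
    ∃ φ : ℝ × E → E, φ (0, 0) = 0 ∧ (∀ᶠ p in 𝓝 (0, 0), ContDiffAt ℝ ∞ φ p) ∧
      ∀ᶠ p in 𝓝 ((0 : ℝ), (0 : E)),
        φ p = p.2 + ∫ τ in (0 : ℝ)..1, p.1 • V (φ (τ * p.1, p.2)) := by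
  let N : C(I, E) → C(I, E) := fun γ => (⟨V, hV.continuous⟩ : C(E, E)).comp γ
  have hN : ContDiff ℝ ∞ N := contDiff_postcomp hV
  let κ : E →L[ℝ] C(I, E) := ContinuousLinearMap.const ℝ I
  -- With time rescaled to `[0, 1]`, the trajectory from `x` run for time `s` solves `γ = x + s ∫ V
  -- ∘ γ`. The second component of `Ψ` is the defect of this equation.
  let Ψ : (ℝ × E) × C(I, E) → (ℝ × E) × C(I, E) := fun z =>
    (z.1, z.2 - κ z.1.2 - z.1.1 • primitive E (N z.2))
  have hΨ : ContDiff ℝ ∞ Ψ := by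
    have h1 : ContDiff ℝ ∞ fun z : (ℝ × E) × C(I, E) => primitive E (N z.2) :=
      (primitive E).contDiff.comp (hN.comp contDiff_snd)
    have h2 : ContDiff ℝ ∞ fun z : (ℝ × E) × C(I, E) => κ z.1.2 :=
      κ.contDiff.comp (contDiff_snd.comp contDiff_fst)
    exact contDiff_fst.prodMk ((contDiff_snd.sub h2).sub ((contDiff_fst.comp contDiff_fst).smul h1))
  let c : C(I, E) := primitive E (N 0)
  let A : (ℝ × E) →L[ℝ] C(I, E) :=
    κ.comp (ContinuousLinearMap.snd ℝ ℝ E) +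
      (ContinuousLinearMap.fst ℝ ℝ E).smulRight c
  -- At the origin the derivative of `Ψ` is the shear `(p, γ) ↦ (p, γ - A p)`, whose inverse is
  -- explicit.
  let e : ((ℝ × E) × C(I, E)) ≃L[ℝ] ((ℝ × E) × C(I, E)) :=
    ContinuousLinearEquiv.equivOfInverse
      ((ContinuousLinearMap.fst ℝ _ _).prod
        (ContinuousLinearMap.snd ℝ _ _ - A.comp (ContinuousLinearMap.fst ℝ _ _)))
      ((ContinuousLinearMap.fst ℝ _ _).prod
        (ContinuousLinearMap.snd ℝ _ _ + A.comp (ContinuousLinearMap.fst ℝ _ _)))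
      (fun z => by simp) (fun z => by simp)
  have he : HasFDerivAt Ψ (e : _ →L[ℝ] _) 0 := by
    have h1 : HasFDerivAt (fun z : (ℝ × E) × C(I, E) => primitive E (N z.2))
        (fderiv ℝ (fun z : (ℝ × E) × C(I, E) => primitive E (N z.2)) 0) 0 :=
      (((primitive E).contDiff.comp (hN.comp contDiff_snd)).differentiable
        (by simp) 0).hasFDerivAt
    have h2 : HasFDerivAt (fun z : (ℝ × E) × C(I, E) => κ z.1.2) _ 0 :=
      (κ.comp ((ContinuousLinearMap.snd ℝ ℝ E).comp
        (ContinuousLinearMap.fst ℝ (ℝ × E) C(I, E)))).hasFDerivAt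
    have h3 : HasFDerivAt (fun z : (ℝ × E) × C(I, E) => z.1.1) _ 0 :=
      ((ContinuousLinearMap.fst ℝ ℝ E).comp
        (ContinuousLinearMap.fst ℝ (ℝ × E) C(I, E))).hasFDerivAt
    have h4 := (hasFDerivAt_fst (𝕜 := ℝ) (p := (0 : (ℝ × E) × C(I, E)))).prodMk
      ((hasFDerivAt_snd.sub h2).sub (h3.smul h1))
    refine h4.congr_fderiv ?_
    ext z <;> simp [e, A, c, sub_sub]
  obtain ⟨g, hg0, -, hgs, hgr, hgl⟩ := exists_smooth_localInverse hΨ e he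
  have hΨ0 : Ψ 0 = 0 := by simp [Ψ]
  rw [hΨ0] at hg0 hgs hgr
  let γ : ℝ × E → C(I, E) := fun p => (g (p, 0)).2
  have hι : Tendsto (fun p : ℝ × E => (p, (0 : C(I, E)))) (𝓝 (0, 0)) (𝓝 0) :=
    (Continuous.prodMk_left (0 : C(I, E))).tendsto' _ _ rfl
  have hgs' := hι.eventually hgs
  have hgr' := hι.eventually hgr
  have hγs : ∀ᶠ p in 𝓝 ((0 : ℝ), (0 : E)), ContDiffAt ℝ ∞ γ p := by
    filter_upwards [hgs'] with p hp
    exact contDiffAt_snd.comp p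
      (ContDiffAt.comp p (f := fun p : ℝ × E => (p, (0 : C(I, E)))) hp
        (contDiff_id.prodMk contDiff_const).contDiffAt)
  have hγ0 : γ (0, 0) = 0 := by
    change (g 0).2 = 0
    rw [hg0]; rfl
  have hγeq : ∀ᶠ p in 𝓝 ((0 : ℝ), (0 : E)), ∀ t : I,
      γ p t = p.2 + p.1 • ∫ τ in (0 : ℝ)..t, V (γ p (Set.projIcc 0 1 zero_le_one τ)) := by
    filter_upwards [hgr'] with p hp t
    have h1 : (g (p, 0)).1 = p := congrArg Prod.fst hp
    have h2 := congrArg Prod.snd hp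
    simp only [Ψ, h1] at h2
    have h3 := DFunLike.congr_fun h2 t
    simp only [ContinuousMap.sub_apply, ContinuousMap.zero_apply, sub_sub, sub_eq_zero] at h3
    exact h3
  -- The curve `τ ↦ γ p (t τ)` solves the equation with time parameter `t s`. It is small, so
  -- injectivity of `Ψ` near the origin identifies it with `γ (t s, x)`.
  have hscale : ∀ᶠ p in 𝓝 ((0 : ℝ), (0 : E)), ∀ t : I,
      γ (t * p.1, p.2) 1 = γ p t := by
    have hcont : Tendsto (fun p => ‖γ p‖) (𝓝 (0, 0)) (𝓝 0) := by
      have := (hγs.self_of_nhds.continuousAt.norm).tendsto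
      rwa [hγ0, norm_zero] at this
    obtain ⟨δ, hδ, hball⟩ := Metric.eventually_nhds_iff_ball.1 hgl
    have hγd := hcont.eventually (gt_mem_nhds hδ)
    filter_upwards [hγd, hγeq, Metric.ball_mem_nhds ((0 : ℝ), (0 : E)) hδ] with p h1 h2 h3 t
    let η : C(I, E) := ⟨fun τ => γ p (t * τ), by fun_prop⟩
    have hη : ‖η‖ < δ := by
      refine lt_of_le_of_lt ?_ h1
      rw [ContinuousMap.norm_le _ (by positivity)]
      exact fun τ => (γ p).norm_coe_le_norm _
    have hz : (((t : ℝ) * p.1, p.2), η) ∈ Metric.ball (0 : (ℝ × E) × C(I, E)) δ := by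
      rw [mem_ball_zero_iff, Prod.norm_def, Prod.norm_def, max_lt_iff, max_lt_iff]
      rw [Metric.mem_ball, dist_eq_norm, Prod.mk_zero_zero, sub_zero, Prod.norm_def,
        max_lt_iff] at h3
      refine ⟨⟨?_, h3.2⟩, hη⟩
      rw [norm_mul, Real.norm_of_nonneg t.2.1]
      exact (mul_le_of_le_one_left (norm_nonneg _) t.2.2).trans_lt h3.1
    have h4 := hball _ hz
    have h5 : Ψ (((t : ℝ) * p.1, p.2), η) = (((t : ℝ) * p.1, p.2), 0) := by
      refine Prod.ext rfl ?_
      ext τ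
      simp only [Ψ, ContinuousMap.sub_apply, ContinuousMap.zero_apply, sub_sub, sub_eq_zero]
      change γ p (t * τ) = p.2 + ((t : ℝ) * p.1) • ∫ s in (0 : ℝ)..τ,
        V (γ p (t * Set.projIcc 0 1 zero_le_one s))
      rw [h2, mul_comm (t : ℝ), mul_smul]
      have h6 : (∫ s in (0 : ℝ)..τ, V (γ p (t * Set.projIcc 0 1 zero_le_one s))) =
          ∫ s in (0 : ℝ)..τ, V (γ p (Set.projIcc 0 1 zero_le_one (t * s))) := by
        refine intervalIntegral.integral_congr fun s hs => ?_
        rw [Set.uIcc_of_le τ.2.1] at hs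
        have hs' : s ∈ Set.Icc (0 : ℝ) 1 := ⟨hs.1, hs.2.trans τ.2.2⟩
        rw [Set.projIcc_of_mem _ hs', Set.projIcc_of_mem zero_le_one
          (⟨mul_nonneg t.2.1 hs'.1, mul_le_one₀ t.2.2 hs'.1 hs'.2⟩ : (t : ℝ) * s ∈ Set.Icc 0 1)]
        rfl
      rw [h6, intervalIntegral.smul_integral_comp_mul_left
        (fun s => V (γ p (Set.projIcc 0 1 zero_le_one s)))]
      simp
    rw [h5] at h4
    have h6 : γ (t * p.1, p.2) = η := congrArg Prod.snd h4
    rw [h6]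
    change γ p (t * 1) = _
    rw [mul_one]
  refine ⟨fun p => γ p 1, by simp [hγ0], ?_, ?_⟩
  · filter_upwards [hγs] with p hp
    exact (ContinuousMap.evalCLM ℝ (1 : I) (M := E)).contDiff.contDiffAt.comp p hp
  · filter_upwards [hγeq, hscale] with p h1 h2
    rw [h1 1, intervalIntegral.integral_smul]
    congr 2
    refine intervalIntegral.integral_congr fun s hs => ?_
    simp only [Set.Icc.coe_one] at hs
    rw [Set.uIcc_of_le zero_le_one] at hs
    rw [Set.projIcc_of_mem _ hs, ← h2 ⟨s, hs⟩]

/-- Smooth vector fields have smooth local flows. -/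
theorem exists_smooth_flow {V : E → E} (hV : ContDiff ℝ ∞ V) :
    ∃ φ : ℝ × E → E, (∀ᶠ p in 𝓝 (0, 0), ContDiffAt ℝ ∞ φ p) ∧
      (∀ᶠ x in 𝓝 0, φ (0, x) = x) ∧
      ∀ᶠ p in 𝓝 ((0 : ℝ), (0 : E)), fderiv ℝ φ p (1, 0) = V (φ p) := by
  obtain ⟨φ, h0, hs, hI⟩ := exists_smooth_integral_flow hV
  refine ⟨φ, hs, ?_, ?_⟩
  · have : Tendsto (fun x : E => ((0 : ℝ), x)) (𝓝 0) (𝓝 (0, 0)) :=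
      (Continuous.prodMk_right (0 : ℝ)).tendsto' _ _ rfl
    filter_upwards [this.eventually hI] with x hx
    simpa using hx
  · obtain ⟨r, hr, h⟩ := Metric.eventually_nhds_iff_ball.1 (hs.and hI)
    filter_upwards [Metric.ball_mem_nhds ((0 : ℝ), (0 : E)) hr] with p hp
    obtain ⟨s, x⟩ := p
    have hball : Metric.ball ((0 : ℝ), (0 : E)) r = Metric.ball (0 : ℝ) r ×ˢ Metric.ball (0 : E) r :=
      (ball_prod_same _ _ _).symm
    have hc : ContinuousOn (fun σ : ℝ => V (φ (σ, x))) (Metric.ball (0 : ℝ) r) := by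
      intro σ hσ
      refine (hV.continuous.continuousAt.comp ?_).continuousWithinAt
      refine ContinuousAt.comp (f := fun σ : ℝ => (σ, x)) ?_ (by fun_prop)
      exact (h (σ, x) (by rw [hball] at hp ⊢; exact ⟨hσ, hp.2⟩)).1.continuousAt
    have hs' : s ∈ Metric.ball (0 : ℝ) r := by rw [hball] at hp; exact hp.1
    -- Substituting `τ ↦ τ σ` gives the usual integral equation, to which the fundamental theorem of
    -- calculus applies.
    have heq : (fun σ => φ (σ, x)) =ᶠ[𝓝 s] fun σ => x + ∫ τ in (0 : ℝ)..σ, V (φ (τ, x)) := by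
      filter_upwards [Metric.isOpen_ball.mem_nhds hs'] with σ hσ
      have := (h (σ, x) (by rw [hball] at hp ⊢; exact ⟨hσ, hp.2⟩)).2
      rw [this, intervalIntegral.integral_smul,
        intervalIntegral.smul_integral_comp_mul_right (fun τ => V (φ (τ, x)))]
      simp
    have hsub : Set.uIcc 0 s ⊆ Metric.ball (0 : ℝ) r :=
      ((convex_ball (0 : ℝ) r).ordConnected).uIcc_subset (Metric.mem_ball_self hr) hs'
    have hd : HasDerivAt (fun σ => x + ∫ τ in (0 : ℝ)..σ, V (φ (τ, x))) (V (φ (s, x))) s := by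
      refine HasDerivAt.const_add x (intervalIntegral.integral_hasDerivAt_right
        ((hc.mono hsub).intervalIntegrable) ?_ (hc.continuousAt (Metric.isOpen_ball.mem_nhds hs')))
      exact hc.stronglyMeasurableAtFilter Metric.isOpen_ball s hs'
    have hd1 := hd.congr_of_eventuallyEq heq
    have hd2 : HasDerivAt (fun σ => φ (σ, x)) (fderiv ℝ φ (s, x) (1, 0)) s :=
      ((h _ hp).1.differentiableAt (by simp)).hasFDerivAt.comp_hasDerivAt s
        ((hasDerivAt_id s).prodMk (hasDerivAt_const s x))
    exact hd2.unique hd1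

end Flow

end ContactGeometry

namespace ContactGeometry
open Filter Module

/-! ### Contact germs, Hamiltonian fields and flow-outs -/

section ContactGerm

variable {E : Type*} [NormedAddCommGroup E] [NormedSpace ℝ E]

/-- The contact condition at a point, for a `1`-form on a normed space. -/
structure IsContactAt (θ : E → E →L[ℝ] ℝ) (x : E) : Prop where
  ne_zero : θ x ≠ 0
  nondegenerate : ∀ v, θ x v = 0 → (∀ w, θ x w = 0 → extDerivForm θ x v w = 0) → v = 0

/-- `L` is an isotropic subspace of the contact hyperplane at `x`. -/
structure IsIsotropicAt (θ : E → E →L[ℝ] ℝ) (x : E) (L : Submodule ℝ E) : Prop where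
  ker : ∀ v ∈ L, θ x v = 0
  isotropic : ∀ v ∈ L, ∀ w ∈ L, extDerivForm θ x v w = 0

/-- `j` parametrizes near `0` an integral submanifold of `ker θ` with tangent space `L` at `0`. -/
structure IsIntegralGerm (θ : E → E →L[ℝ] ℝ) (L : Submodule ℝ E) (j : L → E) : Prop where
  contDiff : ContDiff ℝ ∞ j
  map_zero : j 0 = 0
  hasFDerivAt : HasFDerivAt j L.subtypeL 0
  pullback : ∀ᶠ x in 𝓝 0, pullbackForm j θ x = 0

theorem contDiff_extDerivForm {θ : E → E →L[ℝ] ℝ} (hθ : ContDiff ℝ ∞ θ) :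
    ContDiff ℝ ∞ (extDerivForm θ) := by
  have h : ContDiff ℝ ∞ (fderiv ℝ θ) := hθ.fderiv_right (m := ∞) (by simp)
  let T : (E →L[ℝ] E →L[ℝ] ℝ) →L[ℝ] (E →L[ℝ] E →L[ℝ] ℝ) :=
    (ContinuousLinearMap.flipₗᵢ ℝ E E ℝ).toContinuousLinearEquiv
  have hT : ContDiff ℝ ∞ T := by fun_prop
  exact h.sub (hT.comp h)

/-- Near a contact point, the Hamiltonian field of a smooth function is smooth. -/
theorem IsContactAt.exists_hamiltonian [FiniteDimensional ℝ E] {θ : E → E →L[ℝ] ℝ} (hc : IsContactAt θ 0)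
    (hθ : ContDiff ℝ ∞ θ) {f : E → ℝ} (hf : ContDiff ℝ ∞ f) {Y₀ : E} {h₀ : ℝ}
    (hY₀ : θ 0 Y₀ = 0)
    (hH : ∀ v, extDerivForm θ 0 Y₀ v = fderiv ℝ f 0 v - h₀ * θ 0 v) :
    ∃ (Y : E → E) (h : E → ℝ), ContDiff ℝ ∞ Y ∧ ContDiff ℝ ∞ h ∧ Y 0 = Y₀ ∧
      ∀ᶠ x in 𝓝 0, θ x (Y x) = 0 ∧
        ∀ v, extDerivForm θ x (Y x) v = fderiv ℝ f x v - h x * θ x v := by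
  -- The bordered system `(Y, h) ↦ (Y ⌟ dθ + h θ, θ Y)` has the Hamiltonian pair as its solution for
  -- the right-hand side `(df, 0)`. The contact condition makes it invertible at `0`.
  let B : E → (E × ℝ) →L[ℝ] ((E →L[ℝ] ℝ) × ℝ) := fun x =>
    ((extDerivForm θ x).comp (ContinuousLinearMap.fst ℝ E ℝ) +
      (ContinuousLinearMap.snd ℝ E ℝ).smulRight (θ x)).prod
      ((θ x).comp (ContinuousLinearMap.fst ℝ E ℝ))
  have hB : ContDiff ℝ ∞ B := by
    let T : ((E × ℝ →L[ℝ] E →L[ℝ] ℝ) × (E × ℝ →L[ℝ] ℝ)) →L[ℝ] (E × ℝ →L[ℝ] (E →L[ℝ] ℝ) × ℝ) :=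
      ((ContinuousLinearMap.prodₗᵢ (𝕜 := ℝ) (E := E × ℝ) (F := E →L[ℝ] ℝ) (G := ℝ)
        ℝ).toContinuousLinearEquiv : _ ≃L[ℝ] _)
    have hT : ContDiff ℝ ∞ T := by fun_prop
    refine hT.comp (ContDiff.prodMk ?_ ?_)
    · exact ((contDiff_extDerivForm hθ).clm_comp contDiff_const).add
        (contDiff_const.smulRight hθ)
    · exact hθ.clm_comp contDiff_const
  have hinj : Function.Injective (B 0) := by
    rw [injective_iff_map_eq_zero]
    rintro ⟨Y, h⟩ hz
    have h1 : extDerivForm θ 0 Y + h • θ 0 = 0 := congrArg Prod.fst hz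
    have h2 : θ 0 Y = 0 := congrArg Prod.snd hz
    have hY : Y = 0 := hc.nondegenerate Y h2 fun w hw => by
      simpa [hw] using DFunLike.congr_fun h1 w
    rw [hY, _root_.map_zero, zero_add, smul_eq_zero, or_iff_left hc.ne_zero] at h1
    simp [hY, h1]
  have hfr : finrank ℝ (E × ℝ) = finrank ℝ ((E →L[ℝ] ℝ) × ℝ) := by
    have : finrank ℝ (E →L[ℝ] ℝ) = finrank ℝ E := by
      rw [← (LinearMap.toContinuousLinearMap (𝕜 := ℝ) (E := E) (F' := ℝ)).finrank_eq]
      exact Subspace.dual_finrank_eq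
    simp [this]
  let e : (E × ℝ) ≃L[ℝ] ((E →L[ℝ] ℝ) × ℝ) :=
    (LinearEquiv.ofInjectiveOfFinrankEq (B 0).toLinearMap hinj hfr).toContinuousLinearEquiv
  have he : (e : (E × ℝ) →L[ℝ] ((E →L[ℝ] ℝ) × ℝ)) = B 0 := ContinuousLinearMap.ext fun _ => rfl
  -- `ContinuousLinearMap.inverse` has a junk value at non-invertible maps; only the germ at `0`,
  -- where `B x` is invertible, is used.
  let S : E → E × ℝ := fun x => (B x).inverse (fderiv ℝ f x, 0)
  have hev : ∀ᶠ x in 𝓝 0, ∃ e' : (E × ℝ) ≃L[ℝ] ((E →L[ℝ] ℝ) × ℝ),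
      (e' : (E × ℝ) →L[ℝ] ((E →L[ℝ] ℝ) × ℝ)) = B x :=
    hB.continuous.continuousAt (show Set.range _ ∈ 𝓝 (B 0) from he ▸ e.nhds)
  have hS : ∀ᶠ x in 𝓝 0, ContDiffAt ℝ ∞ S x := by
    filter_upwards [hev] with x ⟨e', he'⟩
    refine ContDiffAt.clm_apply ?_ ((hf.fderiv_right (m := ∞) (by simp)).contDiffAt.prodMk
      contDiffAt_const)
    exact ContDiffAt.comp x (he' ▸ contDiffAt_map_inverse e') hB.contDiffAt
  obtain ⟨T, hT, hTS⟩ := exists_contDiff_eventuallyEq hS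
  refine ⟨fun x => (T x).1, fun x => (T x).2, contDiff_fst.comp hT, contDiff_snd.comp hT, ?_, ?_⟩
  · have h1 : B 0 (Y₀, h₀) = (fderiv ℝ f 0, 0) := by
      refine Prod.ext ?_ hY₀
      ext v
      change extDerivForm θ 0 Y₀ v + h₀ * θ 0 v = _
      rw [hH]; ring
    have h2 : S 0 = (Y₀, h₀) := by
      simp only [S]
      rw [← h1, ← he, ContinuousLinearMap.inverse_equiv]
      simp
    simp only
    rw [hTS.self_of_nhds, h2]
  · filter_upwards [hev, hTS] with x ⟨e', he'⟩ hx
    have h1 : B x (T x) = (fderiv ℝ f x, 0) := by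
      rw [hx]
      simp only [S]
      rw [← he', ContinuousLinearMap.inverse_equiv]
      simp
    refine ⟨congrArg Prod.snd h1, fun v => ?_⟩
    have h2 : extDerivForm θ x (T x).1 v + (T x).2 * θ x v = fderiv ℝ f x v :=
      DFunLike.congr_fun (congrArg Prod.fst h1) v
    linarith

/-- A level set of `f` is parametrized by any subspace of the kernel of `df`. -/
theorem exists_levelSet_parametrization [FiniteDimensional ℝ E] {f : E → ℝ} (hf : ContDiff ℝ ∞ f) {u : E}
    (hu : fderiv ℝ f 0 u = 1) (K : Submodule ℝ E) (hK : ∀ v ∈ K, fderiv ℝ f 0 v = 0) :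
    ∃ ψ : K → E, ContDiff ℝ ∞ ψ ∧ ψ 0 = 0 ∧ HasFDerivAt ψ K.subtypeL 0 ∧
      ∀ᶠ y in 𝓝 0, f (ψ y) = f 0 := by
  -- `Φ` is tangent to the identity at `0`, and since `df₀ u = 1` it satisfies `df₀ (Φ x) = f x - f
  -- 0`. Its local inverse thus carries `ker df₀` into the level set.
  let Φ : E → E := fun x => x + (f x - f 0 - fderiv ℝ f 0 x) • u
  have hΦ : ContDiff ℝ ∞ Φ := contDiff_id.add
    (((hf.sub contDiff_const).sub (fderiv ℝ f 0).contDiff).smul contDiff_const)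
  have hΦ0 : Φ 0 = 0 := by simp [Φ]
  let e : E ≃L[ℝ] E := ContinuousLinearEquiv.refl ℝ E
  have hd : HasFDerivAt Φ (e : E →L[ℝ] E) 0 := by
    have h1 := (hf.differentiable (by simp) 0).hasFDerivAt
    have h2 := (hasFDerivAt_id (𝕜 := ℝ) (0 : E)).fun_add
      (((h1.sub_const (f 0)).sub (fderiv ℝ f 0).hasFDerivAt).smul_const u)
    refine h2.congr_fderiv (ContinuousLinearMap.ext fun v => ?_)
    simp [e]
  obtain ⟨g, hg0, hgd, hgs, hgr, -⟩ := exists_smooth_localInverse hΦ e hd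
  rw [hΦ0] at hg0 hgd hgs hgr
  have hι : Tendsto K.subtypeL (𝓝 0) (𝓝 0) := K.subtypeL.continuous.tendsto' _ _ (by simp)
  obtain ⟨ψ, hψ, hψe⟩ := exists_contDiff_eventuallyEq (g := g ∘ K.subtypeL) (a := 0) (by
    filter_upwards [hι.eventually hgs] with y hy
    exact hy.comp y K.subtypeL.contDiff.contDiffAt)
  refine ⟨ψ, hψ, by simpa [hg0] using hψe.self_of_nhds, ?_, ?_⟩
  · refine HasFDerivAt.congr_of_eventuallyEq ?_ hψe
    have h1 : HasFDerivAt g (e.symm : E →L[ℝ] E) (K.subtypeL 0) := by rw [_root_.map_zero]; exact hgd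
    exact (h1.comp (0 : K) K.subtypeL.hasFDerivAt).congr_fderiv (by ext; simp [e])
  · filter_upwards [hψe, hι.eventually hgr] with y hy h1
    rw [hy, Function.comp_apply]
    have h2 := congrArg (fderiv ℝ f 0) h1
    simp only [Φ, map_add, map_smul, hu, smul_eq_mul, mul_one, Submodule.subtypeL_apply,
      hK y y.2] at h2
    simp only [Submodule.subtypeL_apply]
    linarith

/-- Uniqueness for a linear equation whose right-hand side is `K`-Lipschitz in `u`, by comparison
with the zero solution; nothing is asked of `a` beyond boundedness. -/
theorem eqOn_zero_of_hasDerivAt_mul {u a : ℝ → ℝ} {r K : ℝ}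
    (hu : ∀ t ∈ Set.Ioo (-r) r, HasDerivAt u (a t * u t) t) (ha : ∀ t ∈ Set.Ioo (-r) r, |a t| ≤ K)
    (h0 : u 0 = 0) : ∀ t ∈ Set.Ioo (-r) r, u t = 0 := by
  intro t ht
  have hr : (0 : ℝ) ∈ Set.Ioo (-r) r := by
    constructor <;> linarith [ht.1, ht.2]
  have hK : 0 ≤ K := (abs_nonneg _).trans (ha 0 hr)
  refine ODE_solution_unique_of_mem_Ioo (v := fun t x => a t * x) (s := fun _ => Set.univ)
    (K := ⟨K, hK⟩) (g := fun _ => 0) (fun t ht => ?_) hr (fun t ht => ⟨hu t ht, trivial⟩)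
    (fun t ht => ⟨by simpa using hasDerivAt_const t (0 : ℝ), trivial⟩) h0 ht
  refine (LipschitzWith.of_dist_le_mul fun x y => ?_).lipschitzOnWith
  rw [dist_eq_norm, dist_eq_norm, ← mul_sub, norm_mul]
  exact mul_le_mul_of_nonneg_right (ha t ht) (norm_nonneg _)

theorem fderiv_apply_of_eventuallyEq_const {F : Type*} [NormedAddCommGroup F] [NormedSpace ℝ F]
    {J : F → E} {f : E → ℝ} {p : F} (hJ : DifferentiableAt ℝ J p)
    (hf : DifferentiableAt ℝ f (J p)) {c : ℝ} (h : ∀ᶠ q in 𝓝 p, f (J q) = c) (w : F) :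
    fderiv ℝ f (J p) (fderiv ℝ J p w) = 0 := by
  have h1 : HasFDerivAt (f ∘ J) (0 : F →L[ℝ] ℝ) p :=
    (hasFDerivAt_const c p).congr_of_eventuallyEq h
  exact DFunLike.congr_fun ((hf.hasFDerivAt.comp p hJ.hasFDerivAt).unique h1) w

theorem hasDerivAt_prodMk_left {G : Type*} [NormedAddCommGroup G] [NormedSpace ℝ G] (s : ℝ)
    (y : G) : HasDerivAt (fun σ : ℝ => (σ, y)) (1, 0) s :=
  (hasDerivAt_id s).prodMk (hasDerivAt_const s y)

/-- Cartan's formula for a form `α` with `ι_{∂ₛ} α = 0`. -/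
theorem hasDerivAt_form_of_apply_eq_zero {G : Type*} [NormedAddCommGroup G] [NormedSpace ℝ G]
    {α : ℝ × G → (ℝ × G) →L[ℝ] ℝ} {t : ℝ} {y : G} (hα : DifferentiableAt ℝ α (t, y))
    (h : ∀ᶠ p in 𝓝 (t, y), α p (1, 0) = 0) (w : ℝ × G) :
    HasDerivAt (fun σ => α (σ, y) w) (extDerivForm α (t, y) (1, 0) w) t := by
  have e0 := hα.hasFDerivAt.clm_apply (hasFDerivAt_const ((1 : ℝ), (0 : G)) (t, y))
  -- The contraction of `α` with `∂ₛ` vanishes identically near the point, so only the `∂ₛ (α w)`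
  -- term of `dα (∂ₛ, w)` survives.
  have e1 : fderiv ℝ α (t, y) w (1, 0) = 0 := by
    simpa using DFunLike.congr_fun (e0.unique
      ((hasFDerivAt_const (0 : ℝ) (t, y)).congr_of_eventuallyEq h)) w
  have h7 : HasDerivAt (fun σ => α (σ, y)) (fderiv ℝ α (t, y) (1, 0)) t :=
    hα.hasFDerivAt.comp_hasDerivAt t (hasDerivAt_prodMk_left t y)
  have h8 := h7.clm_apply (hasDerivAt_const t w)
  rw [extDerivForm_apply, e1, sub_zero]
  simpa using h8

/-- The flow-out along a Hamiltonian field of an integral submanifold of `ker θ` contained in a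
level set of `f` is an integral submanifold of `ker θ` contained in that level set. -/
theorem pullbackForm_flowOut_eq_zero {G : Type*} [NormedAddCommGroup G] [NormedSpace ℝ G]
    {θ : E → E →L[ℝ] ℝ} (hθ : ContDiff ℝ ∞ θ) {f : E → ℝ} (hf : ContDiff ℝ ∞ f) {Y : E → E}
    {h : E → ℝ} (hh : ContDiff ℝ ∞ h) {c : ℝ}
    (hY : ∀ᶠ x in 𝓝 0, θ x (Y x) = 0 ∧
        ∀ v, extDerivForm θ x (Y x) v = fderiv ℝ f x v - h x * θ x v)
    {J : ℝ × G → E} (hJ0 : J (0, 0) = 0) (hJ : ∀ᶠ p in 𝓝 (0, 0), ContDiffAt ℝ ∞ J p)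
    (hJY : ∀ᶠ p in 𝓝 (0, 0), fderiv ℝ J p (1, 0) = Y (J p))
    (hf0 : ∀ᶠ y in 𝓝 0, f (J (0, y)) = c)
    (hθ0 : ∀ᶠ y in 𝓝 0, ∀ w, pullbackForm J θ (0, y) (0, w) = 0) :
    ∀ᶠ p in 𝓝 (0, 0), f (J p) = c ∧ pullbackForm J θ p = 0 := by
  have hJc : Tendsto J (𝓝 (0, 0)) (𝓝 0) := by
    have := hJ.self_of_nhds.continuousAt.tendsto
    rwa [hJ0] at this
  have hsnd : Tendsto (Prod.snd : ℝ × G → G) (𝓝 (0, 0)) (𝓝 0) :=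
    continuous_snd.tendsto' _ _ rfl
  have hbd : ∀ᶠ p in 𝓝 ((0 : ℝ), (0 : G)), |h (J p)| < |h 0| + 1 :=
    hJc.eventually ((hh.continuous.abs.continuousAt).eventually (gt_mem_nhds (by linarith)))
  obtain ⟨r, hr, H⟩ := Metric.eventually_nhds_iff_ball.1
    (hJ.and (hJY.and ((hJc.eventually hY).and (hbd.and
      ((hsnd.eventually hf0).and (hsnd.eventually hθ0))))))
  have hball : ∀ {s : ℝ} {y : G}, (s, y) ∈ Metric.ball ((0 : ℝ), (0 : G)) r ↔
      s ∈ Set.Ioo (-r) r ∧ y ∈ Metric.ball 0 r := by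
    intro s y
    rw [← ball_prod_same, Set.mem_prod, Real.ball_eq_Ioo, zero_sub, zero_add]
  have hfJ : ∀ p ∈ Metric.ball ((0 : ℝ), (0 : G)) r, f (J p) = c := by
    rintro ⟨s, y⟩ hp
    obtain ⟨hs, hy⟩ := hball.1 hp
    -- `f` is constant along the flow because `df(Y) = dθ(Y, Y) + h θ(Y) = 0`.
    have h0 := eqOn_zero_of_hasDerivAt_mul (u := fun σ => f (J (σ, y)) - c) (a := fun _ => 0)
      (r := r) (K := 0) (fun t ht => ?_) (by simp) ?_ s hs
    · exact sub_eq_zero.1 h0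
    · obtain ⟨h1, h2, h3, -⟩ := H (t, y) (hball.2 ⟨ht, hy⟩)
      have h4 := (hf.differentiable (by simp) (J (t, y))).hasFDerivAt.comp_hasDerivAt t
        ((h1.differentiableAt (by simp)).hasFDerivAt.comp_hasDerivAt t (hasDerivAt_prodMk_left t y))
      have h5 := h3.2 (Y (J (t, y)))
      rw [extDerivForm_self, h3.1, mul_zero, sub_zero] at h5
      rw [h2, ← h5] at h4
      rw [zero_mul]
      exact h4.sub_const c
    · exact sub_eq_zero.2 (H (s, y) hp).2.2.2.2.1
  have hα1 : ∀ p ∈ Metric.ball ((0 : ℝ), (0 : G)) r, pullbackForm J θ p (1, 0) = 0 := by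
    intro p hp
    rw [pullbackForm_apply, (H p hp).2.1, (H p hp).2.2.1.1]
  have hα2 : ∀ p ∈ Metric.ball ((0 : ℝ), (0 : G)) r, ∀ w,
      pullbackForm J θ p (0, w) = 0 := by
    rintro ⟨s, y⟩ hp w
    obtain ⟨hs, hy⟩ := hball.1 hp
    -- Since `f ∘ J` is constant, the term `df` in `Y ⌟ dθ = df - h θ` pulls back to zero, leaving
    -- `u' = -h u` with `u 0 = 0`.
    refine eqOn_zero_of_hasDerivAt_mul (u := fun σ => pullbackForm J θ (σ, y) (0, w))
      (a := fun σ => -h (J (σ, y))) (r := r) (K := |h 0| + 1) (fun t ht => ?_)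
      (fun t ht => ?_) ((H (s, y) hp).2.2.2.2.2 w) s hs
    · have hq := hball.2 ⟨ht, hy⟩
      obtain ⟨h1, h2, h3, -⟩ := H (t, y) hq
      have hnear := Metric.isOpen_ball.mem_nhds hq
      have hdα : DifferentiableAt ℝ (pullbackForm J θ) (t, y) :=
        ((hθ.contDiffAt.comp _ h1).clm_comp (h1.fderiv_right (m := ∞) (by simp))).differentiableAt
          (by simp)
      have e2 : fderiv ℝ f (J (t, y)) (fderiv ℝ J (t, y) (0, w)) = 0 :=
        fderiv_apply_of_eventuallyEq_const (h1.differentiableAt (by simp))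
          (hf.differentiable (by simp) _) (by filter_upwards [hnear] with p hp using hfJ p hp) _
      have e3 := extDerivForm_pullbackForm h1 (hθ.differentiable (by simp) (J (t, y)))
        (1, 0) (0, w)
      rw [h2, h3.2, e2, zero_sub, ← pullbackForm_apply, ← neg_mul] at e3
      have h7 := hasDerivAt_form_of_apply_eq_zero hdα
        (by filter_upwards [hnear] with p hp using hα1 p hp) (0, w)
      exact e3 ▸ h7
    · rw [abs_neg]
      exact (H (t, y) (hball.2 ⟨ht, hy⟩)).2.2.2.1.le
  filter_upwards [Metric.ball_mem_nhds ((0 : ℝ), (0 : G)) hr] with p hp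
  refine ⟨hfJ p hp, ?_⟩
  refine ContinuousLinearMap.ext fun ⟨a, w⟩ => ?_
  have : ((a, w) : ℝ × G) = a • (1, 0) + (0, w) := by simp
  rw [this, map_add, map_smul, hα1 p hp, hα2 p hp]
  simp

end ContactGerm

end ContactGeometry

namespace ContactGeometry
open Filter Module

/-! ### Integral manifolds with prescribed tangent space in a level set -/

section Existence

universe u
variable {E : Type u} [NormedAddCommGroup E] [NormedSpace ℝ E]

/-- Nondegeneracy provides a vector of `ker θ` on which `dθ(Y₀, ·) = df` is nonzero. Subtracting
multiples of `Y₀`, and then of `u`, clears the remaining coordinates, so that `Y₀, u, z` form a dual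
triple to `l, df, θ`. -/
theorem IsContactAt.exists_adapted {θ : E → E →L[ℝ] ℝ} (hc : IsContactAt θ 0)
    {df l : E →L[ℝ] ℝ} {Y₀ : E} {h₀ : ℝ} (hθY : θ 0 Y₀ = 0) (hY₀ : Y₀ ≠ 0) (hl : l Y₀ = 1)
    (hH : ∀ v, extDerivForm θ 0 Y₀ v = df v - h₀ * θ 0 v) :
    df Y₀ = 0 ∧ (∃ u, θ 0 u = 0 ∧ df u = 1 ∧ l u = 0) ∧ ∃ z, θ 0 z = 1 ∧ df z = 0 ∧ l z = 0 := by
  have hdY : df Y₀ = 0 := by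
    have := hH Y₀
    rw [extDerivForm_self, hθY] at this
    linarith
  have hu : ∃ u, θ 0 u = 0 ∧ df u = 1 ∧ l u = 0 := by
    obtain ⟨w, hw, hw'⟩ : ∃ w, θ 0 w = 0 ∧ extDerivForm θ 0 Y₀ w ≠ 0 := by
      by_contra hcon
      push Not at hcon
      exact hY₀ (hc.nondegenerate Y₀ hθY hcon)
    rw [hH, hw, mul_zero, sub_zero] at hw'
    refine ⟨(df w)⁻¹ • (w - l w • Y₀), ?_, ?_, ?_⟩
    · simp [hw, hθY]
    · simp [hdY, hw']
    · simp [hl]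
  refine ⟨hdY, hu, ?_⟩
  obtain ⟨u, hu1, hu2, hu3⟩ := hu
  obtain ⟨z, hz⟩ : ∃ z, θ 0 z ≠ 0 := by
    by_contra hcon
    push Not at hcon
    exact hc.ne_zero (ContinuousLinearMap.ext hcon)
  refine ⟨(θ 0 z)⁻¹ • (z - l z • Y₀ - df z • u), ?_, ?_, ?_⟩
  · simp [hθY, hu1, hz]
  · simp [hdY, hu2]
  · simp [hl, hu3]

/-- A transversal to the Hamiltonian field inside a level set is again a contact manifold. -/
theorem IsContactAt.slice {θ : E → E →L[ℝ] ℝ} (hc : IsContactAt θ 0) (hθ : ContDiff ℝ ∞ θ)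
    {df l : E →L[ℝ] ℝ} {Y₀ : E} {h₀ : ℝ} (hθY : θ 0 Y₀ = 0) (hY₀ : Y₀ ≠ 0) (hl : l Y₀ = 1)
    (hH : ∀ v, extDerivForm θ 0 Y₀ v = df v - h₀ * θ 0 v) {K : Submodule ℝ E}
    (hK : ∀ v, v ∈ K ↔ df v = 0 ∧ l v = 0) {ψ : K → E} (hψ : ContDiff ℝ ∞ ψ) (hψ0 : ψ 0 = 0)
    (hdψ : HasFDerivAt ψ K.subtypeL 0) :
    IsContactAt (pullbackForm ψ θ) 0 ∧ ∀ L, IsIsotropicAt θ 0 L →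
      IsIsotropicAt (pullbackForm ψ θ) 0 (L.comap K.subtype) := by
  obtain ⟨hdY, ⟨u, hu1, hu2, hu3⟩, z, hz1, hz2, hz3⟩ := hc.exists_adapted hθY hY₀ hl hH
  have e1 : ∀ v : K, pullbackForm ψ θ 0 v = θ 0 v := fun v => by
    rw [pullbackForm_apply, hψ0, hdψ.fderiv]; rfl
  have e2 : ∀ v w : K, extDerivForm (pullbackForm ψ θ) 0 v w = extDerivForm θ 0 v w := fun v w => by
    rw [extDerivForm_pullbackForm hψ.contDiffAt (hθ.differentiable (by simp) _), hψ0, hdψ.fderiv]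
    rfl
  refine ⟨⟨fun h => ?_, fun v hv hvw => ?_⟩, fun L hL => ⟨fun v hv => ?_, fun v hv w hw => ?_⟩⟩
  · have := e1 ⟨z, (hK z).2 ⟨hz2, hz3⟩⟩
    rw [h, hz1] at this
    simp at this
  · rw [e1] at hv
    obtain ⟨hv1, hv2⟩ := (hK v).1 v.2
    have hvY : extDerivForm θ 0 v Y₀ = 0 := by
      rw [extDerivForm_swap, hH, hv1, hv]; simp
    -- On `ker θ` the form `dθ(v, ·)` kills `Y₀` and the slice directions, hence is the multiple
    -- `dθ(v, u)` of `df = dθ(Y₀, ·)`. Nondegeneracy makes `v` that multiple of `Y₀`, and applying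
    -- `l` shows the factor is zero.
    have key : (v : E) - extDerivForm θ 0 v u • Y₀ = 0 := by
      refine hc.nondegenerate _ (by simp [hv, hθY]) fun w hw => ?_
      have h1 := hvw ⟨w - l w • Y₀ - df w • u, (hK _).2 ⟨by simp [hdY, hu2], by simp [hl, hu3]⟩⟩
        (by rw [e1]; simp [hw, hθY, hu1])
      rw [e2] at h1
      have h2 : extDerivForm θ 0 v w = df w * extDerivForm θ 0 v u := by
        simpa [hvY, sub_eq_zero] using h1
      have h3 := hH w
      rw [hw, mul_zero, sub_zero] at h3
      simp only [map_sub, map_smul, _root_.sub_apply, _root_.smul_apply,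
        smul_eq_mul, h2, h3]
      ring
    have hb : extDerivForm θ 0 v u = 0 := by
      have := congrArg l key
      simpa [hv2, hl] using this
    rw [hb, zero_smul, sub_zero] at key
    exact Subtype.ext key
  · rw [e1]; exact hL.ker _ hv
  · rw [e2]; exact hL.isotropic _ hv _ hw

theorem isIntegralGerm_bot {θ : E → E →L[ℝ] ℝ} {L : Submodule ℝ E} (hL : L = ⊥) :
    IsIntegralGerm θ L fun _ => 0 := by
  subst hL
  refine ⟨contDiff_const, rfl, (hasFDerivAt_const _ _).congr_fderiv ?_, Eventually.of_forall
    fun x => ?_⟩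
  · ext x; rw [Subsingleton.elim x 0]; simp
  · ext x; rw [Subsingleton.elim x 0]; simp

variable [FiniteDimensional ℝ E]

/-- Inductive step: integral submanifolds in a contact transversal of a level set flow out to
integral submanifolds in the level set. -/
theorem exists_integralGerm_levelSet_of_slice {θ : E → E →L[ℝ] ℝ} (hc : IsContactAt θ 0)
    (hθ : ContDiff ℝ ∞ θ) {f : E → ℝ} (hf : ContDiff ℝ ∞ f) {L : Submodule ℝ E}
    (hL : IsIsotropicAt θ 0 L) {Y₀ : E} {h₀ : ℝ} (hYL : Y₀ ∈ L) (hY₀ : Y₀ ≠ 0)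
    (hH : ∀ v, extDerivForm θ 0 Y₀ v = fderiv ℝ f 0 v - h₀ * θ 0 v)
    (IH : ∀ (K : Submodule ℝ E) (θ' : K → K →L[ℝ] ℝ) (L' : Submodule ℝ K), ContDiff ℝ ∞ θ' →
      IsContactAt θ' 0 → IsIsotropicAt θ' 0 L' → finrank ℝ L' < finrank ℝ L →
      ∃ j, IsIntegralGerm θ' L' j) :
    ∃ j, IsIntegralGerm θ L j ∧ ∀ᶠ x in 𝓝 0, f (j x) = f 0 := by
  have hθY := hL.ker Y₀ hYL
  obtain ⟨l, hl⟩ := SeparatingDual.exists_eq_one (R := ℝ) hY₀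
  obtain ⟨hdY, ⟨u, -, hu, -⟩, -⟩ := hc.exists_adapted hθY hY₀ hl hH
  -- `ker df` is the tangent space of the level set, and `ker l` cuts it transversally to `Y₀`.
  let K : Submodule ℝ E := LinearMap.ker (fderiv ℝ f 0).toLinearMap ⊓ LinearMap.ker l.toLinearMap
  have hK : ∀ v, v ∈ K ↔ fderiv ℝ f 0 v = 0 ∧ l v = 0 := fun v => Iff.rfl
  obtain ⟨ψ, hψ, hψ0, hdψ, hfψ⟩ := exists_levelSet_parametrization hf hu K fun v hv => hv.1
  obtain ⟨hcK, hisoK⟩ := hc.slice hθ hθY hY₀ hl hH hK hψ hψ0 hdψ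
  let L' : Submodule ℝ K := L.comap K.subtype
  -- `Y₀` lies in `L` but not in `K`, since `l Y₀ = 1`.
  have hlt : finrank ℝ L' < finrank ℝ L := by
    rw [← Submodule.finrank_map_subtype_eq K L']
    refine Submodule.finrank_lt_finrank_of_lt (lt_of_le_of_ne ?_ fun h => ?_)
    · rw [Submodule.map_comap_subtype]; exact inf_le_right
    · have : Y₀ ∈ L'.map K.subtype := h ▸ hYL
      rw [Submodule.map_comap_subtype] at this
      exact one_ne_zero (hl.symm.trans this.1.2)
  obtain ⟨i, hi⟩ := IH K (pullbackForm ψ θ) L' (contDiff_pullbackForm hψ hθ) hcK (hisoK L hL) hlt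
  obtain ⟨Y, h, hY, hh, hYY₀, hYham⟩ := hc.exists_hamiltonian hθ hf hθY hH
  obtain ⟨φ, hφs, hφ0, hφV⟩ := exists_smooth_flow hY
  let g : L' → E := fun x => ψ (i x)
  have hg : ContDiff ℝ ∞ g := hψ.comp hi.contDiff
  have hg0 : g 0 = 0 := by simp [g, hi.map_zero, hψ0]
  let q : ℝ × L' → ℝ × E := fun p => (p.1, g p.2)
  have hq : ContDiff ℝ ∞ q := contDiff_fst.prodMk (hg.comp contDiff_snd)
  have hq0 : q (0, 0) = (0, 0) := by simp [q, hg0]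
  have hqt : Tendsto q (𝓝 (0, 0)) (𝓝 (0, 0)) := hq.continuous.tendsto' _ _ hq0
  let J : ℝ × L' → E := fun p => φ (q p)
  have hJ0 : J (0, 0) = 0 := by
    simp only [J, hq0]; exact hφ0.self_of_nhds
  have hJs : ∀ᶠ p in 𝓝 (0, 0), ContDiffAt ℝ ∞ J p := by
    filter_upwards [hqt.eventually hφs] with p hp using hp.comp p hq.contDiffAt
  have hfJ : ∀ p, ContDiffAt ℝ ∞ φ (q p) → ∀ a w,
      fderiv ℝ J p (a, w) = fderiv ℝ φ (q p) (a, fderiv ℝ g p.2 w) := by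
    intro p hp a w
    have h1 : HasFDerivAt q ((ContinuousLinearMap.fst ℝ ℝ L').prod
        ((fderiv ℝ g p.2).comp (ContinuousLinearMap.snd ℝ ℝ L'))) p :=
      hasFDerivAt_fst.prodMk
        ((hg.differentiable (by simp) p.2).hasFDerivAt.comp p hasFDerivAt_snd)
    have h2 : fderiv ℝ J p = _ := ((hp.differentiableAt (by simp)).hasFDerivAt.comp p h1).fderiv
    rw [h2]
    simp
  have hJY : ∀ᶠ p in 𝓝 (0, 0), fderiv ℝ J p (1, 0) = Y (J p) := by
    filter_upwards [hqt.eventually hφV, hqt.eventually hφs] with p hp hp'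
    rw [hfJ p hp', _root_.map_zero, hp]
  have hgt : Tendsto g (𝓝 0) (𝓝 0) := hg.continuous.tendsto' _ _ hg0
  have hit : Tendsto i (𝓝 0) (𝓝 0) := hi.contDiff.continuous.tendsto' _ _ hi.map_zero
  have hzero : Tendsto (fun y : L' => ((0 : ℝ), y)) (𝓝 0) (𝓝 (0, 0)) :=
    (Continuous.prodMk_right (0 : ℝ)).tendsto' _ _ rfl
  have hJ0y : ∀ᶠ y in 𝓝 (0 : L'), J (0, y) = g y := hgt.eventually hφ0
  have hdJ0 : ∀ᶠ y in 𝓝 (0 : L'), ∀ w, fderiv ℝ J (0, y) (0, w) = fderiv ℝ g y w := by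
    filter_upwards [hJ0y.eventually_nhds, hzero.eventually hJs] with y hy hJy w
    have h1 := (hJy.differentiableAt (by simp)).hasFDerivAt.comp y
      ((hasFDerivAt_const (0 : ℝ) y).prodMk (hasFDerivAt_id (𝕜 := ℝ) y))
    have h2 := h1.unique ((hg.differentiable (by simp) y).hasFDerivAt.congr_of_eventuallyEq hy)
    exact DFunLike.congr_fun h2 w
  have hmain := pullbackForm_flowOut_eq_zero (c := f 0) hθ hf hh hYham hJ0 hJs hJY
    (by filter_upwards [hJ0y, hit.eventually hfψ] with y h1 h2
        rw [h1, ← h2])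
    (by filter_upwards [hJ0y, hdJ0, hi.pullback] with y h1 h2 h3 w
        rw [pullbackForm_apply, h1, h2]
        have h4 := DFunLike.congr_fun h3 w
        rw [pullbackForm_apply, pullbackForm_apply] at h4
        have h5 : HasFDerivAt g ((fderiv ℝ ψ (i y)).comp (fderiv ℝ i y)) y :=
          (hψ.differentiable (by simp) _).hasFDerivAt.comp y
            (hi.contDiff.differentiable (by simp) y).hasFDerivAt
        rw [h5.fderiv]
        exact h4)
  -- `L` is isotropic and contains `Y₀`, so it lies in `ker df`; hence projecting `L` along `Y₀`
  -- onto `ker l` lands in `K`.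
  have hdf : ∀ x : L, fderiv ℝ f 0 x = 0 := fun x => by
    have h1 := hH x
    rw [hL.isotropic _ hYL _ x.2, hL.ker _ x.2] at h1
    linarith
  let P : L →ₗ[ℝ] L' :=
    { toFun := fun x => ⟨⟨x - l x • Y₀, (hK _).2 ⟨by simp [hdY, hdf], by simp [hl]⟩⟩,
        L.sub_mem x.2 (L.smul_mem _ hYL)⟩
      map_add' := fun x y => by
        ext; simp only [Submodule.coe_add, map_add, add_smul]; abel
      map_smul' := fun c x => by
        ext; simp [smul_sub, mul_smul] }
  -- The splitting of `L` into a flow-time coordinate along `Y₀` and a slice coordinate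
  -- reparametrises `J` so that its derivative at `0` is the inclusion of `L`.
  let A : L →L[ℝ] ℝ × L' := (l.comp L.subtypeL).prod (LinearMap.toContinuousLinearMap P)
  have hAt : Tendsto A (𝓝 0) (𝓝 (0, 0)) := A.continuous.tendsto' _ _ (_root_.map_zero A)
  obtain ⟨j, hj, hjJ⟩ := exists_contDiff_eventuallyEq (g := J ∘ A) (a := 0) (by
    filter_upwards [hAt.eventually hJs] with x hx using hx.comp x A.contDiff.contDiffAt)
  refine ⟨j, ⟨hj, ?_, ?_, ?_⟩, ?_⟩
  · rw [hjJ.self_of_nhds, Function.comp_apply, _root_.map_zero]; exact hJ0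
  · refine HasFDerivAt.congr_of_eventuallyEq ?_ hjJ
    have h1 : HasFDerivAt J (fderiv ℝ J (0, 0)) (A 0) := by
      rw [_root_.map_zero]
      exact (hJs.self_of_nhds.differentiableAt (by simp)).hasFDerivAt
    refine (h1.comp (0 : L) A.hasFDerivAt).congr_fderiv (ContinuousLinearMap.ext fun x => ?_)
    have h2 : A x = l x • ((1 : ℝ), (0 : L')) + (0, P x) := by simp [A]
    have h3 : fderiv ℝ g 0 = (K.subtypeL).comp L'.subtypeL := by
      have h4 : HasFDerivAt ψ K.subtypeL (i 0) := by rw [hi.map_zero]; exact hdψ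
      exact (h4.comp (0 : L') hi.hasFDerivAt).fderiv
    rw [ContinuousLinearMap.comp_apply, h2, map_add, map_smul, hJY.self_of_nhds,
      hdJ0.self_of_nhds, hJ0, hYY₀, h3]
    simp [P]
  · filter_upwards [hjJ.eventually_nhds, hAt.eventually hmain, hAt.eventually hJs] with x h1 h2 h3
    have h4 : HasFDerivAt j ((fderiv ℝ J (A x)).comp A) x :=
      ((h3.differentiableAt (by simp)).hasFDerivAt.comp x A.hasFDerivAt).congr_of_eventuallyEq h1
    ext w
    rw [pullbackForm_apply, h4.fderiv, h1.self_of_nhds]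
    exact DFunLike.congr_fun h2.2 (A w)
  · filter_upwards [hjJ, hAt.eventually hmain] with x h1 h2
    rw [h1]; exact h2.1

/-- A nonzero `Y₀ ∈ L` is the Hamiltonian vector, with `h₀ = 0`, of the linear function `dθ(Y₀, ·)`
at `0`, so the inductive step applies and its level-set conclusion is discarded. The ambient space
varies because each slice lives on a new `K`. -/
theorem exists_integralGerm_of_finrank (n : ℕ) :
    ∀ {E : Type u} [NormedAddCommGroup E] [NormedSpace ℝ E] [FiniteDimensional ℝ E]
      {θ : E → E →L[ℝ] ℝ} {L : Submodule ℝ E}, ContDiff ℝ ∞ θ → IsContactAt θ 0 →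
      IsIsotropicAt θ 0 L → finrank ℝ L = n → ∃ j, IsIntegralGerm θ L j := by
  induction n using Nat.strong_induction_on with
  | _ n ih =>
    intro E _ _ _ θ L hθ hc hL hn
    by_cases hbot : L = ⊥
    · exact ⟨_, isIntegralGerm_bot hbot⟩
    · obtain ⟨Y₀, hYL, hY₀⟩ := (Submodule.ne_bot_iff L).1 hbot
      obtain ⟨j, hj, -⟩ := exists_integralGerm_levelSet_of_slice (h₀ := 0) hc hθ
        (extDerivForm θ 0 Y₀).contDiff hL hYL hY₀ (fun v => by
          rw [ContinuousLinearMap.fderiv]; simp)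
        (fun K θ' L' hθ' hc' hL' hlt => ih _ (hn ▸ hlt) hθ' hc' hL' rfl)
      exact ⟨j, hj⟩

/-- Existence of integral submanifolds of a contact structure inside a level set of `f`, with
prescribed tangent space containing the Hamiltonian vector of `f`. -/
theorem exists_integralGerm_levelSet {θ : E → E →L[ℝ] ℝ} (hc : IsContactAt θ 0)
    (hθ : ContDiff ℝ ∞ θ) {f : E → ℝ} (hf : ContDiff ℝ ∞ f) {L : Submodule ℝ E}
    (hL : IsIsotropicAt θ 0 L) {Y₀ : E} {h₀ : ℝ} (hYL : Y₀ ∈ L) (hY₀ : Y₀ ≠ 0)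
    (hH : ∀ v, extDerivForm θ 0 Y₀ v = fderiv ℝ f 0 v - h₀ * θ 0 v) :
    ∃ j, IsIntegralGerm θ L j ∧ ∀ᶠ x in 𝓝 0, f (j x) = f 0 :=
  exists_integralGerm_levelSet_of_slice hc hθ hf hL hYL hY₀ hH
    fun _ _ _ hθ' hc' hL' _ => exists_integralGerm_of_finrank _ hθ' hc' hL' rfl

/-- Such submanifolds can be parametrized as graphs over their tangent space. -/
theorem exists_integralGerm_levelSet_graph {θ : E → E →L[ℝ] ℝ} (hc : IsContactAt θ 0)
    (hθ : ContDiff ℝ ∞ θ) {f : E → ℝ} (hf : ContDiff ℝ ∞ f) {L : Submodule ℝ E}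
    (hL : IsIsotropicAt θ 0 L) {Y₀ : E} {h₀ : ℝ} (hYL : Y₀ ∈ L) (hY₀ : Y₀ ≠ 0)
    (hH : ∀ v, extDerivForm θ 0 Y₀ v = fderiv ℝ f 0 v - h₀ * θ 0 v) :
    ∃ (j : L → E) (p : E →L[ℝ] L), IsIntegralGerm θ L j ∧ (∀ᶠ x in 𝓝 0, f (j x) = f 0) ∧
      ∀ᶠ x in 𝓝 0, p (j x) = x := by
  obtain ⟨i, hi, hfi⟩ := exists_integralGerm_levelSet hc hθ hf hL hYL hY₀ hH
  obtain ⟨p, hp⟩ := LinearMap.exists_leftInverse_of_injective L.subtype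
    (LinearMap.ker_eq_bot.2 L.injective_subtype)
  let p' : E →L[ℝ] L := LinearMap.toContinuousLinearMap p
  have hp' : ∀ x : L, p' x = x := fun x => LinearMap.congr_fun hp x
  let e : L ≃L[ℝ] L := ContinuousLinearEquiv.refl ℝ L
  -- Composed with a linear projection onto `L`, the parametrization is tangent to the identity;
  -- precomposing with its local inverse turns it into a graph.
  have hd : HasFDerivAt (p' ∘ i) (e : L →L[ℝ] L) 0 :=
    (p'.hasFDerivAt.comp (0 : L) hi.hasFDerivAt).congr_fderiv
      (ContinuousLinearMap.ext fun x => hp' x)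
  obtain ⟨g, hg0, hgd, hgs, hgr, -⟩ := exists_smooth_localInverse (p'.contDiff.comp hi.contDiff) e hd
  have h0 : (p' ∘ i) 0 = 0 := by simp [hi.map_zero]
  rw [h0] at hg0 hgd hgs hgr
  obtain ⟨G, hG, hGg⟩ := exists_contDiff_eventuallyEq hgs
  have hG0 : G 0 = 0 := hGg.self_of_nhds.trans hg0
  have hGt : Tendsto G (𝓝 0) (𝓝 0) := hG.continuous.tendsto' _ _ hG0
  have hGd : HasFDerivAt G (e.symm : L →L[ℝ] L) 0 := hgd.congr_of_eventuallyEq hGg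
  refine ⟨i ∘ G, p', ⟨hi.contDiff.comp hG, by simp [hG0, hi.map_zero], ?_, ?_⟩, ?_, ?_⟩
  · have h1 : HasFDerivAt i L.subtypeL (G 0) := by rw [hG0]; exact hi.hasFDerivAt
    exact (h1.comp (0 : L) hGd).congr_fderiv (ContinuousLinearMap.ext fun x => rfl)
  · filter_upwards [hGt.eventually hi.pullback] with x hx
    ext w
    have h1 : HasFDerivAt (i ∘ G) ((fderiv ℝ i (G x)).comp (fderiv ℝ G x)) x :=
      (hi.contDiff.differentiable (by simp) _).hasFDerivAt.comp x
        (hG.differentiable (by simp) x).hasFDerivAt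
    rw [pullbackForm_apply, h1.fderiv]
    exact DFunLike.congr_fun hx _
  · exact hGt.eventually hfi
  · filter_upwards [hgr, hGg] with x h1 h2
    rw [Function.comp_apply, h2]; exact h1

end Existence

end ContactGeometry

namespace ContactGeometry
open Module

/-! ### Lagrangian subspaces of a symplectic space -/

section Symplectic

variable {W : Type*} [AddCommGroup W] [Module ℝ W] {B : LinearMap.BilinForm ℝ W}

theorem orthogonal_sup (B : LinearMap.BilinForm ℝ W) (S T : Submodule ℝ W) :
    B.orthogonal (S ⊔ T) = B.orthogonal S ⊓ B.orthogonal T := by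
  refine le_antisymm (le_inf (LinearMap.BilinForm.orthogonal_le le_sup_left)
    (LinearMap.BilinForm.orthogonal_le le_sup_right)) fun x hx y hy => ?_
  obtain ⟨s, hs, t, ht, rfl⟩ := Submodule.mem_sup.1 hy
  have h1 : B s x = 0 := hx.1 s hs
  have h2 : B t x = 0 := hx.2 t ht
  simp [h1, h2]

variable [FiniteDimensional ℝ W]

/-- In a symplectic space, an isotropic subspace transversal to a half-dimensional subspace `D` and
to its orthogonal complement extends to a Lagrangian subspace transversal to `D`. -/
theorem exists_lagrangian_transversal (hB : B.Nondegenerate) (ha : B.IsAlt) {n : ℕ}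
    (hW : finrank ℝ W = 2 * n) {D : Submodule ℝ W} (hD : finrank ℝ D = n) (m : ℕ) :
    ∀ {I : Submodule ℝ W}, finrank ℝ I + m = n → I ≤ B.orthogonal I → I ⊓ D = ⊥ →
      I ⊓ B.orthogonal D = ⊥ →
      ∃ L, I ≤ L ∧ finrank ℝ L = n ∧ L ≤ B.orthogonal L ∧ L ⊓ D = ⊥ := by
  have hr : B.IsRefl := ha.isRefl
  induction m with
  | zero => exact fun {I} hI h1 h2 _ => ⟨I, le_rfl, hI, h1, h2⟩
  | succ m ih =>
    intro I hI h1 h2 h3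
    have hDD : B.orthogonal (B.orthogonal D) = D := B.orthogonal_orthogonal hB hr D
    have hDo : finrank ℝ (B.orthogonal D) = n := by rw [B.finrank_orthogonal hB, hW, hD]; omega
    -- With `r = dim I < n`, the right-hand side has dimension at most `r + (2n - (n + r)) = n`,
    -- while `dim I^⊥ = 2n - r > n`.
    have dim : ∀ T : Submodule ℝ W, finrank ℝ T = n → I ⊓ T = ⊥ →
        ¬ B.orthogonal I ≤ I ⊔ (B.orthogonal T ⊓ B.orthogonal I) := by
      intro T hT hIT hle
      have e1 := Submodule.finrank_mono hle
      have e2 := Submodule.finrank_add_le_finrank_add_finrank I (B.orthogonal T ⊓ B.orthogonal I)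
      have e3 := Submodule.finrank_sup_add_finrank_inf_eq I T
      rw [hIT, finrank_bot] at e3
      rw [← orthogonal_sup, B.finrank_orthogonal hB, sup_comm T I] at e2
      rw [B.finrank_orthogonal hB, ← orthogonal_sup, sup_comm T I] at e1
      omega
    -- A subspace covered by two subspaces lies in one of them, which `dim` excludes for both `D`
    -- and `D^⊥`. Avoiding `D^⊥` too is what keeps the induction going.
    have hnot : ∃ v ∈ B.orthogonal I, v ∉ I ⊔ (D ⊓ B.orthogonal I) ∧
        v ∉ I ⊔ (B.orthogonal D ⊓ B.orthogonal I) := by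
      by_contra hcon
      push Not at hcon
      have : (B.orthogonal I : Set W) ⊆ (I ⊔ (D ⊓ B.orthogonal I) : Submodule ℝ W) ∪
          (I ⊔ (B.orthogonal D ⊓ B.orthogonal I) : Submodule ℝ W) := fun v hv =>
        or_iff_not_imp_left.2 (hcon v hv)
      rcases AddSubgroupClass.subset_union.1 this with h | h
      · have := dim _ hDo h3
        rw [hDD] at this
        exact this h
      · exact dim D hD h2 h
    obtain ⟨v, hv, hv1, hv2⟩ := hnot
    have hvI : v ∉ I := fun h => hv1 (Submodule.mem_sup_left h)
    have hIle : I ⊔ Submodule.span ℝ {v} ≤ B.orthogonal I :=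
      sup_le h1 (by rwa [Submodule.span_singleton_le_iff_mem])
    have htrans : ∀ T : Submodule ℝ W, I ⊓ T = ⊥ → v ∉ I ⊔ (T ⊓ B.orthogonal I) →
        (I ⊔ Submodule.span ℝ {v}) ⊓ T = ⊥ := by
      intro T hT hvT
      rw [Submodule.eq_bot_iff]
      rintro x ⟨hx, hxT⟩
      have hxo := hIle hx
      obtain ⟨i, hi, y, hy, rfl⟩ := Submodule.mem_sup.1 hx
      obtain ⟨c, rfl⟩ := Submodule.mem_span_singleton.1 hy
      by_cases hc : c = 0
      · subst hc
        rw [zero_smul, add_zero] at hxT ⊢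
        exact (Submodule.mem_bot ℝ).1 (hT ▸ ⟨hi, hxT⟩)
      · refine absurd ?_ hvT
        have : v = c⁻¹ • (-i + (i + c • v)) := by
          rw [neg_add_cancel_left, smul_smul, inv_mul_cancel₀ hc, one_smul]
        rw [this]
        exact Submodule.smul_mem _ _ (Submodule.add_mem _
          (Submodule.mem_sup_left (I.neg_mem hi)) (Submodule.mem_sup_right ⟨hxT, hxo⟩))
    obtain ⟨L, hL, hL'⟩ := ih (I := I ⊔ Submodule.span ℝ {v})
      (by rw [Submodule.finrank_sup_span_singleton hvI]; omega)
      (by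
        rw [orthogonal_sup]
        refine le_inf hIle (sup_le ?_ ?_)
        · intro x hx y hy
          obtain ⟨c, rfl⟩ := Submodule.mem_span_singleton.1 hy
          have : B v x = 0 := hr _ _ (hv x hx)
          simp [this]
        · rw [Submodule.span_singleton_le_iff_mem]
          intro y hy
          obtain ⟨c, rfl⟩ := Submodule.mem_span_singleton.1 hy
          simp [ha.self_eq_zero])
      (htrans D h2 hv1) (htrans _ h3 hv2)
    exact ⟨L, le_sup_left.trans hL, hL'⟩

theorem exists_lagrangian_transversal_mem (hB : B.Nondegenerate) (ha : B.IsAlt) {n : ℕ}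
    (hW : finrank ℝ W = 2 * n) {D : Submodule ℝ W} (hD : finrank ℝ D = n) {y : W} (hy : y ∉ D)
    (hy' : y ∉ B.orthogonal D) :
    ∃ L : Submodule ℝ W, y ∈ L ∧ finrank ℝ L = n ∧ L ≤ B.orthogonal L ∧ L ⊓ D = ⊥ := by
  have hy0 : y ≠ 0 := fun h0 => hy (h0 ▸ D.zero_mem)
  have hn : n ≠ 0 := by
    rintro rfl
    exact hy0 (Subsingleton.elim (h := finrank_zero_iff.1 hW) _ _)
  have key : ∀ T : Submodule ℝ W, y ∉ T → Submodule.span ℝ {y} ⊓ T = ⊥ := fun T hT => by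
    rw [Submodule.eq_bot_iff]
    rintro x ⟨hx, hxT⟩
    obtain ⟨c, rfl⟩ := Submodule.mem_span_singleton.1 hx
    by_cases hc : c = 0
    · simp [hc]
    · exact absurd ((T.smul_mem_iff hc).1 hxT) hT
  obtain ⟨L, hyL, hL⟩ := exists_lagrangian_transversal hB ha hW hD (n - 1)
    (I := Submodule.span ℝ {y}) (by rw [finrank_span_singleton hy0]; omega)
    (by
      intro x hx z hz
      obtain ⟨c, rfl⟩ := Submodule.mem_span_singleton.1 hx
      obtain ⟨c', rfl⟩ := Submodule.mem_span_singleton.1 hz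
      simp [ha.self_eq_zero])
    (key _ hy) (key _ hy')
  exact ⟨L, hyL (Submodule.mem_span_singleton_self _), hL⟩

/-- A Lagrangian subspace is its own orthogonal complement. -/
theorem orthogonal_lagrangian (hB : B.Nondegenerate) {n : ℕ} (hW : finrank ℝ W = 2 * n)
    {L : Submodule ℝ W} (hL : finrank ℝ L = n) (h : L ≤ B.orthogonal L) : B.orthogonal L = L :=
  (Submodule.eq_of_le_of_finrank_eq h (by rw [B.finrank_orthogonal hB, hW, hL]; omega)).symm

/-- If `L ∩ D` were zero, `L + D` would be everything by dimension, and `L ∩ D^⊥ = (L + D)^⊥` would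
vanish. -/
theorem lagrangian_inf_ne_bot (hB : B.Nondegenerate) {n : ℕ} (hW : finrank ℝ W = 2 * n)
    {L D : Submodule ℝ W} (hL : finrank ℝ L = n) (h : L ≤ B.orthogonal L) (hD : finrank ℝ D = n)
    (hLD : L ⊓ B.orthogonal D ≠ ⊥) : L ⊓ D ≠ ⊥ := by
  intro hbot
  have e := Submodule.finrank_sup_add_finrank_inf_eq L D
  rw [hbot, finrank_bot, hL, hD] at e
  have h1 : finrank ℝ (B.orthogonal (L ⊔ D)) = 0 := by
    rw [B.finrank_orthogonal hB, hW]; omega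
  rw [orthogonal_sup, orthogonal_lagrangian hB hW hL h] at h1
  exact hLD (Submodule.finrank_eq_zero.1 h1)

end Symplectic

/-! ### Linear contact structures, reduced to the symplectic kernel -/

section LinearContact

variable {V : Type*} [AddCommGroup V] [Module ℝ V]

/-- A linear contact structure: a linear form `θ` and an alternating form `Ω` which is nondegenerate
on the kernel of `θ`. -/
structure IsLinearContact (n : ℕ) (θ : V →ₗ[ℝ] ℝ) (Ω : LinearMap.BilinForm ℝ V) : Prop where
  finrank_eq : finrank ℝ V = 2 * n + 1
  ne_zero : θ ≠ 0
  isAlt : Ω.IsAlt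
  nondegenerate : ∀ v, θ v = 0 → (∀ w, θ w = 0 → Ω v w = 0) → v = 0

namespace IsLinearContact

variable {n : ℕ} {θ : V →ₗ[ℝ] ℝ} {Ω : LinearMap.BilinForm ℝ V}

theorem finiteDimensional (h : IsLinearContact n θ Ω) : FiniteDimensional ℝ V :=
  FiniteDimensional.of_finrank_pos (by rw [h.finrank_eq]; omega)

theorem finrank_ker (h : IsLinearContact n θ Ω) : finrank ℝ (LinearMap.ker θ) = 2 * n := by
  have := h.finiteDimensional
  have h1 := Module.Dual.finrank_ker_add_one_of_ne_zero h.ne_zero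
  rw [h.finrank_eq] at h1
  omega

theorem isAlt_restrict (h : IsLinearContact n θ Ω) :
    (Ω.restrict (LinearMap.ker θ)).IsAlt := fun v => h.isAlt v

theorem nondegenerate_restrict (h : IsLinearContact n θ Ω) :
    (Ω.restrict (LinearMap.ker θ)).Nondegenerate := by
  refine (LinearMap.IsRefl.nondegenerate_iff_separatingLeft h.isAlt_restrict.isRefl).2 ?_
  exact fun v hv => Subtype.ext (h.nondegenerate v v.2 fun w hw => hv ⟨w, hw⟩)

theorem finrank_comap {C S : Submodule ℝ V} (hS : S ≤ C) :
    finrank ℝ (S.comap C.subtype) = finrank ℝ S :=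
  (Submodule.comapSubtypeEquivOfLe hS).finrank_eq

theorem inf_comap_eq_bot {C S T : Submodule ℝ V} (hS : S ≤ C) :
    S.comap C.subtype ⊓ T.comap C.subtype = ⊥ ↔ S ⊓ T = ⊥ := by
  simp only [Submodule.eq_bot_iff]
  constructor
  · rintro h x ⟨h1, h2⟩
    exact congrArg Subtype.val (h ⟨x, hS h1⟩ ⟨h1, h2⟩)
  · rintro h x ⟨h1, h2⟩
    exact Subtype.ext (h x ⟨h1, h2⟩)

theorem exists_lagrangian (h : IsLinearContact n θ Ω) {D : Submodule ℝ V}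
    (hDC : D ≤ LinearMap.ker θ) (hD : finrank ℝ D = n) {y : V} (hy : θ y = 0) (hyD : y ∉ D)
    (hyD' : ¬ ∀ w ∈ D, Ω w y = 0) :
    ∃ L ≤ LinearMap.ker θ, y ∈ L ∧ finrank ℝ L = n ∧ (∀ v ∈ L, ∀ w ∈ L, Ω v w = 0) ∧
      L ⊓ D = ⊥ := by
  have := h.finiteDimensional
  obtain ⟨L, hyL, hL, hLi, hLD⟩ := exists_lagrangian_transversal_mem
    h.nondegenerate_restrict h.isAlt_restrict h.finrank_ker
    (D := D.comap (LinearMap.ker θ).subtype) (by rw [finrank_comap hDC, hD]) (y := ⟨y, hy⟩) hyD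
    fun hmem => hyD' fun w hw => hmem ⟨w, hDC hw⟩ hw
  refine ⟨L.map (LinearMap.ker θ).subtype, Submodule.map_subtype_le _ _, ⟨⟨y, hy⟩, hyL, rfl⟩,
    ?_, ?_, ?_⟩
  · rw [Submodule.finrank_map_subtype_eq, hL]
  · rintro _ ⟨v, hv, rfl⟩ _ ⟨w, hw, rfl⟩
    exact hLi hw v hv
  · rw [← inf_comap_eq_bot (Submodule.map_subtype_le _ _),
      Submodule.comap_map_eq_of_injective (LinearMap.ker θ).injective_subtype, hLD]

/-- Maximality of Lagrangian planes: this is what puts the Hamiltonian vector into the tangent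
planes of solutions. -/
theorem mem_of_lagrangian (h : IsLinearContact n θ Ω) {L : Submodule ℝ V}
    (hLC : L ≤ LinearMap.ker θ) (hL : finrank ℝ L = n) (hLi : ∀ v ∈ L, ∀ w ∈ L, Ω v w = 0) {y : V}
    (hy : θ y = 0) (hyL : ∀ v ∈ L, Ω v y = 0) : y ∈ L := by
  have := h.finiteDimensional
  have h1 := orthogonal_lagrangian (B := Ω.restrict (LinearMap.ker θ)) h.nondegenerate_restrict
    h.finrank_ker (L := L.comap (LinearMap.ker θ).subtype) (by rw [finrank_comap hLC, hL])
    (fun v hv w hw => hLi w hw v hv)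
  have h2 : (⟨y, hy⟩ : LinearMap.ker θ) ∈ (Ω.restrict (LinearMap.ker θ)).orthogonal
      (L.comap (LinearMap.ker θ).subtype) := fun v hv => hyL v hv
  rw [h1] at h2
  exact h2

theorem inf_ne_bot (h : IsLinearContact n θ Ω) {L D : Submodule ℝ V}
    (hLC : L ≤ LinearMap.ker θ) (hL : finrank ℝ L = n) (hLi : ∀ v ∈ L, ∀ w ∈ L, Ω v w = 0)
    (hDC : D ≤ LinearMap.ker θ) (hD : finrank ℝ D = n) {y : V} (hy : y ≠ 0) (hyL : y ∈ L)
    (hyD : ∀ w ∈ D, Ω w y = 0) : L ⊓ D ≠ ⊥ := by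
  have := h.finiteDimensional
  rw [Ne, ← inf_comap_eq_bot hLC]
  refine lagrangian_inf_ne_bot (B := Ω.restrict (LinearMap.ker θ)) h.nondegenerate_restrict
    h.finrank_ker (by rw [finrank_comap hLC, hL]) (fun v hv w hw => hLi w hw v hv)
    (by rw [finrank_comap hDC, hD]) fun hbot => hy ?_
  have : (⟨y, hLC hyL⟩ : LinearMap.ker θ) ∈ (⊥ : Submodule ℝ (LinearMap.ker θ)) :=
    hbot ▸ ⟨hyL, fun w hw => hyD w hw⟩
  exact congrArg Subtype.val ((Submodule.mem_bot ℝ).1 this)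

theorem mem_of_orthogonal_orthogonal (h : IsLinearContact n θ Ω) {D : Submodule ℝ V}
    (hDC : D ≤ LinearMap.ker θ) {y : V} (hy : θ y = 0)
    (hyD : ∀ w, θ w = 0 → (∀ u ∈ D, Ω u w = 0) → Ω w y = 0) : y ∈ D := by
  have := h.finiteDimensional
  have h1 := LinearMap.BilinForm.orthogonal_orthogonal h.nondegenerate_restrict
    h.isAlt_restrict.isRefl (D.comap (LinearMap.ker θ).subtype)
  have h2 : (⟨y, hy⟩ : LinearMap.ker θ) ∈ (Ω.restrict (LinearMap.ker θ)).orthogonal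
      ((Ω.restrict (LinearMap.ker θ)).orthogonal (D.comap (LinearMap.ker θ).subtype)) :=
    fun w hw => hyD w w.2 fun u hu => hw ⟨u, hDC hu⟩ hu
  rw [h1] at h2
  exact h2

end IsLinearContact

end LinearContact

end ContactGeometry

namespace ContactGeometry
open Filter Module

/-! ### Forms, functions and vector fields in the preferred charts -/

section Charts

variable {d k : ℕ} {M : Type*} [TopologicalSpace M] [ChartedSpace (Model d) M]

/-- The derivative at `q` of the change of coordinates from the preferred chart at `q` to the
preferred chart at `x₀`. -/
noncomputable def coordChangeDeriv (d : ℕ) {M : Type*} [TopologicalSpace M]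
    [ChartedSpace (Model d) M] (x₀ q : M) : Model d →L[ℝ] Model d :=
  fderiv ℝ (extChartAt (𝓡 d) x₀ ∘ (extChartAt (𝓡 d) q).symm) (extChartAt (𝓡 d) q q)

/-- The tangent space at `m` is read in the preferred chart at `m`. The base point is a separate
variable because `j x` is often equal to it only propositionally. -/
theorem mfderiv_apply_eq_fderiv {j : Model k → M} {x : Model k} {m : M} (h : j x = m)
    (hj : MDifferentiableAt (𝓡 k) (𝓡 d) j x) (v : Model k) :
    (mfderiv (𝓡 k) (𝓡 d) j x v : Model d) = fderiv ℝ (extChartAt (𝓡 d) m ∘ j) x v := by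
  subst h
  refine (congrArg (fun A : Model k →L[ℝ] Model d => A v) hj.mfderiv).trans ?_
  simp only [writtenInExtChartAt, mfld_simps, fderivWithin_univ]
  rfl

theorem coordChangeDeriv_self (q : M) : coordChangeDeriv d q q = ContinuousLinearMap.id ℝ _ := by
  have h : (extChartAt (𝓡 d) q ∘ (extChartAt (𝓡 d) q).symm) =ᶠ[𝓝 (extChartAt (𝓡 d) q q)] id := by
    filter_upwards [extChartAt_target_mem_nhds (I := 𝓡 d) q] with x hx
    exact (extChartAt (𝓡 d) q).right_inv hx
  rw [coordChangeDeriv, h.fderiv_eq, fderiv_id]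

theorem eventuallyEq_extChartAt_symm_comp {j : Model k → M} {x : Model k} {x₀ : M}
    (hx : j x ∈ (extChartAt (𝓡 d) x₀).source) (hj : ContinuousAt j x) :
    j =ᶠ[𝓝 x] (extChartAt (𝓡 d) x₀).symm ∘ (extChartAt (𝓡 d) x₀ ∘ j) := by
  filter_upwards [hj ((isOpen_extChartAt_source x₀).mem_nhds hx)] with y hy
  exact ((extChartAt (𝓡 d) x₀).left_inv hy).symm

/-- The two sides involve covectors at different base points, so the equality is transported through
`h1` instead of rewritten. -/
theorem form_mfderiv_congr (θ : ∀ m : M, Covector d m) {i j : Model k → M} {x : Model k}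
    (h : j =ᶠ[𝓝 x] i) (v : Model k) :
    θ (j x) (mfderiv (𝓡 k) (𝓡 d) j x v) = θ (i x) (mfderiv (𝓡 k) (𝓡 d) i x v) := by
  have h1 : ∀ (q : M) (_ : q = i x) (w w' : Model d), w = w' →
      θ q (w : TangentSpace (𝓡 d) q) = θ (i x) (w' : TangentSpace (𝓡 d) (i x)) := by
    rintro q rfl w w' rfl; rfl
  refine h1 _ h.self_of_nhds _ _ ?_
  exact DFunLike.congr_fun h.mfderiv_eq v

theorem IsSmoothForm.contDiffAt {θ : ∀ m : M, Covector d m} (hθ : IsSmoothForm θ) {x₀ : M}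
    {x : Model d} (hx : x ∈ (extChartAt (𝓡 d) x₀).target) :
    ContDiffAt ℝ ∞ (chartForm θ x₀) x :=
  (hθ x₀).contDiffAt ((isOpen_extChartAt_target x₀).mem_nhds hx)

variable [IsManifold (𝓡 d) ∞ M]

theorem contMDiffAt_extChartAt_symm' {x₀ : M} {x : Model d}
    (hx : x ∈ (extChartAt (𝓡 d) x₀).target) :
    ContMDiffAt (𝓡 d) (𝓡 d) ∞ (extChartAt (𝓡 d) x₀).symm x :=
  (contMDiffOn_extChartAt_symm x₀).contMDiffAt ((isOpen_extChartAt_target x₀).mem_nhds hx)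

theorem contMDiffAt_extChartAt_of_mem {x₀ q : M} (hq : q ∈ (extChartAt (𝓡 d) x₀).source) :
    ContMDiffAt (𝓡 d) (𝓡 d) ∞ (extChartAt (𝓡 d) x₀) q :=
  contMDiffAt_extChartAt' (by rwa [extChartAt_source] at hq)

theorem contDiffAt_extChartAt_comp {j : Model k → M} {x : Model k} {x₀ : M}
    (hx : j x ∈ (extChartAt (𝓡 d) x₀).source) (hj : ContMDiffAt (𝓡 k) (𝓡 d) ∞ j x) :
    ContDiffAt ℝ ∞ (extChartAt (𝓡 d) x₀ ∘ j) x :=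
  ((contMDiffAt_extChartAt_of_mem hx).comp x hj).contDiffAt

/-- The pullback of a form under `j`, computed in the chart at `x₀`. -/
theorem form_mfderiv_eq_pullbackForm (θ : ∀ m : M, Covector d m) {j : Model k → M} {x : Model k}
    {x₀ : M} (hx : j x ∈ (extChartAt (𝓡 d) x₀).source) (hj : ContMDiffAt (𝓡 k) (𝓡 d) ∞ j x)
    (v : Model k) :
    θ (j x) (mfderiv (𝓡 k) (𝓡 d) j x v) =
      pullbackForm (extChartAt (𝓡 d) x₀ ∘ j) (chartForm θ x₀) x v := by
  rw [form_mfderiv_congr θ (eventuallyEq_extChartAt_symm_comp hx hj.continuousAt) v]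
  have h1 : MDifferentiableAt (𝓡 d) (𝓡 d) (extChartAt (𝓡 d) x₀).symm
      ((extChartAt (𝓡 d) x₀ ∘ j) x) :=
    (contMDiffAt_extChartAt_symm' ((extChartAt (𝓡 d) x₀).map_source hx)).mdifferentiableAt
      (by simp)
  have h2 : DifferentiableAt ℝ (extChartAt (𝓡 d) x₀ ∘ j) x :=
    (contDiffAt_extChartAt_comp hx hj).differentiableAt (by simp)
  rw [mfderiv_comp x h1 h2.mdifferentiableAt, mfderiv_eq_fderiv]
  rfl

theorem chartForm_eventuallyEq_pullbackForm (θ : ∀ m : M, Covector d m) {x₀ q : M}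
    (hq : q ∈ (extChartAt (𝓡 d) x₀).source) :
    chartForm θ q =ᶠ[𝓝 (extChartAt (𝓡 d) q q)]
      pullbackForm (extChartAt (𝓡 d) x₀ ∘ (extChartAt (𝓡 d) q).symm) (chartForm θ x₀) := by
  have h1 : ContinuousAt (extChartAt (𝓡 d) q).symm (extChartAt (𝓡 d) q q) :=
    (contMDiffAt_extChartAt_symm' (mem_extChartAt_target q)).continuousAt
  have h2 : (extChartAt (𝓡 d) x₀).source ∈
      𝓝 ((extChartAt (𝓡 d) q).symm (extChartAt (𝓡 d) q q)) := by
    rw [extChartAt_to_inv]; exact (isOpen_extChartAt_source x₀).mem_nhds hq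
  filter_upwards [extChartAt_target_mem_nhds (I := 𝓡 d) q, h1 h2] with y hy hy'
  ext v
  exact form_mfderiv_eq_pullbackForm θ hy' (contMDiffAt_extChartAt_symm' hy) v

theorem chartForm_self (θ : ∀ m : M, Covector d m) (q : M) :
    chartForm θ q (extChartAt (𝓡 d) q q) = θ q := by
  have h1 : ∀ (q' : M) (_ : q' = q) (w w' : Model d), w = w' →
      θ q' (w : TangentSpace (𝓡 d) q') = θ q (w' : TangentSpace (𝓡 d) q) := by
    rintro q' rfl w w' rfl; rfl
  refine ContinuousLinearMap.ext fun v => h1 _ (extChartAt_to_inv q) _ _ ?_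
  have h2 := mfderiv_apply_eq_fderiv (extChartAt_to_inv (I := 𝓡 d) q)
    ((contMDiffAt_extChartAt_symm' (mem_extChartAt_target q)).mdifferentiableAt (by simp)) v
  refine h2.trans ?_
  have h3 := coordChangeDeriv_self (d := d) q
  rw [coordChangeDeriv] at h3
  rw [h3]; rfl

theorem contDiffAt_coordChange {x₀ q : M} (hq : q ∈ (extChartAt (𝓡 d) x₀).source) :
    ContDiffAt ℝ ∞ (extChartAt (𝓡 d) x₀ ∘ (extChartAt (𝓡 d) q).symm) (extChartAt (𝓡 d) q q) :=
  contDiffAt_extChartAt_comp (by rwa [extChartAt_to_inv])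
    (contMDiffAt_extChartAt_symm' (mem_extChartAt_target q))

theorem form_eq_chartForm (θ : ∀ m : M, Covector d m) {x₀ q : M}
    (hq : q ∈ (extChartAt (𝓡 d) x₀).source) (v : Model d) :
    θ q v = chartForm θ x₀ (extChartAt (𝓡 d) x₀ q) (coordChangeDeriv d x₀ q v) := by
  have h := (chartForm_eventuallyEq_pullbackForm θ hq).self_of_nhds
  rw [chartForm_self] at h
  refine (DFunLike.congr_fun h v).trans ?_
  rw [pullbackForm_apply, Function.comp_apply, extChartAt_to_inv]
  rfl

/-- Naturality of the exterior derivative under changes of charts. -/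
theorem extDer_eq_extDerivForm {θ : ∀ m : M, Covector d m} (hθ : IsSmoothForm θ) {x₀ q : M}
    (hq : q ∈ (extChartAt (𝓡 d) x₀).source) (v w : Model d) :
    extDer θ q v w = extDerivForm (chartForm θ x₀) (extChartAt (𝓡 d) x₀ q)
      (coordChangeDeriv d x₀ q v) (coordChangeDeriv d x₀ q w) := by
  change extDerivForm (chartForm θ q) (extChartAt (𝓡 d) q q) v w = _
  rw [extDerivForm_congr (chartForm_eventuallyEq_pullbackForm θ hq), extDerivForm_pullbackForm
    (contDiffAt_coordChange hq), Function.comp_apply, extChartAt_to_inv]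
  · rfl
  · rw [Function.comp_apply, extChartAt_to_inv]
    exact (hθ.contDiffAt ((extChartAt (𝓡 d) x₀).map_source hq)).differentiableAt (by simp)

theorem contDiffAt_comp_extChartAt_symm {f : M → ℝ} (hf : ContMDiff (𝓡 d) 𝓘(ℝ, ℝ) ∞ f) {x₀ : M}
    {x : Model d} (hx : x ∈ (extChartAt (𝓡 d) x₀).target) :
    ContDiffAt ℝ ∞ (f ∘ (extChartAt (𝓡 d) x₀).symm) x :=
  (hf.contMDiffAt.comp x (contMDiffAt_extChartAt_symm' hx)).contDiffAt

theorem mvfderiv_eq_fderiv {f : M → ℝ} (hf : ContMDiff (𝓡 d) 𝓘(ℝ, ℝ) ∞ f) {x₀ q : M}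
    (hq : q ∈ (extChartAt (𝓡 d) x₀).source) (v : Model d) :
    mvfderiv (𝓡 d) f q v = fderiv ℝ (f ∘ (extChartAt (𝓡 d) x₀).symm) (extChartAt (𝓡 d) x₀ q)
      (coordChangeDeriv d x₀ q v) := by
  have h0 : MDifferentiableAt (𝓡 d) 𝓘(ℝ, ℝ) f q := hf.contMDiffAt.mdifferentiableAt (by simp)
  have h1 : mvfderiv (𝓡 d) f q v =
      fderiv ℝ (f ∘ (extChartAt (𝓡 d) q).symm) (extChartAt (𝓡 d) q q) v := by
    refine (congrArg (fun A : Model d →L[ℝ] ℝ => A v) h0.mfderiv).trans ?_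
    simp only [writtenInExtChartAt, mfld_simps, fderivWithin_univ]
    rfl
  have h2 := eventuallyEq_extChartAt_symm_comp (x₀ := x₀) (x := extChartAt (𝓡 d) q q)
    (j := (extChartAt (𝓡 d) q).symm) (by rwa [extChartAt_to_inv])
    (contMDiffAt_extChartAt_symm' (mem_extChartAt_target q)).continuousAt
  have h3 : f ∘ (extChartAt (𝓡 d) q).symm =ᶠ[𝓝 (extChartAt (𝓡 d) q q)]
      (f ∘ (extChartAt (𝓡 d) x₀).symm) ∘ (extChartAt (𝓡 d) x₀ ∘ (extChartAt (𝓡 d) q).symm) := by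
    filter_upwards [h2] with y hy
    exact congrArg f hy
  have h4 : (extChartAt (𝓡 d) x₀ ∘ (extChartAt (𝓡 d) q).symm) (extChartAt (𝓡 d) q q) =
      extChartAt (𝓡 d) x₀ q := by rw [Function.comp_apply, extChartAt_to_inv]
  rw [h1, h3.fderiv_eq, fderiv_comp, h4]
  · rfl
  · rw [h4]
    exact (contDiffAt_comp_extChartAt_symm hf
      ((extChartAt (𝓡 d) x₀).map_source hq)).differentiableAt (by simp)
  · exact (contDiffAt_coordChange hq).differentiableAt (by simp)

theorem coordChangeDeriv_surjective {x₀ q : M} (hq : q ∈ (extChartAt (𝓡 d) x₀).source) :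
    Function.Surjective (coordChangeDeriv d x₀ q) := by
  have h1 : coordChangeDeriv d x₀ q = mfderiv (𝓡 d) (𝓡 d) (extChartAt (𝓡 d) x₀) q := by
    refine Eq.symm ?_
    refine (((contMDiffAt_extChartAt_of_mem hq).mdifferentiableAt (by simp)).mfderiv).trans ?_
    simp only [writtenInExtChartAt, mfld_simps, fderivWithin_univ, coordChangeDeriv]
    rfl
  have h2 : (mfderiv (𝓡 d) (𝓡 d) (extChartAt (𝓡 d) x₀) q).IsInvertible :=
    isInvertible_mfderiv_extChartAt hq
  intro v
  obtain ⟨w, hw⟩ := h2.bijective.2 v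
  exact ⟨w, (DFunLike.congr_fun h1 w).trans hw⟩

/-- The coordinate change to the chart at `x₀` is the fibre part of the tangent bundle
trivialization at `x₀`. -/
theorem continuousAt_coordChangeDeriv_section {X : ∀ m : M, TangentSpace (𝓡 d) m} {x₀ : M}
    (hX : ContMDiffAt (𝓡 d) (𝓡 d).tangent ∞
      (fun m => (⟨m, X m⟩ : TangentBundle (𝓡 d) M)) x₀) :
    ContinuousAt (fun q => coordChangeDeriv d x₀ q (X q)) x₀ := by
  have h := (Bundle.contMDiffAt_section (IB := 𝓡 d) (F := Model d) (E := TangentSpace (𝓡 d))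
    (s := X) x₀).1 hX
  refine h.continuousAt.congr (Eventually.of_forall fun q => ?_)
  simp only [TangentBundle.trivializationAt_apply, mfld_simps, fderivWithin_univ, coordChangeDeriv]

end Charts

end ContactGeometry

namespace ContactGeometry
open Filter Module

/-! ### Globally smooth models of `θ` and `f` near a point -/

section LocalModel

variable {d : ℕ} {M : Type*} [TopologicalSpace M] [ChartedSpace (Model d) M]

theorem tendsto_extChartAt_sub (m : M) : Tendsto (fun q => extChartAt (𝓡 d) m q - extChartAt (𝓡 d) m m) (𝓝 m)
    (𝓝 0) := by
  have := (continuousAt_extChartAt (I := 𝓡 d) m).sub_const (extChartAt (𝓡 d) m m)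
  simpa [ContinuousAt] using this

variable [IsManifold (𝓡 d) ∞ M]

/-- A pair of a smooth `1`-form and a smooth function on `ℝ ^ d` which represents `(θ, f)` near `m`,
in the preferred chart at `m` translated so that `m` corresponds to the origin. -/
structure IsLocalModel (θ : ∀ m : M, Covector d m) (f : M → ℝ) (m : M)
    (η : Model d → Model d →L[ℝ] ℝ) (g : Model d → ℝ) : Prop where
  contDiff_form : ContDiff ℝ ∞ η
  contDiff_fun : ContDiff ℝ ∞ g
  form_eq : ∀ᶠ x in 𝓝 0, η x = chartForm θ m (x + extChartAt (𝓡 d) m m)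
  fun_eq : ∀ᶠ x in 𝓝 0, g x = f ((extChartAt (𝓡 d) m).symm (x + extChartAt (𝓡 d) m m))

theorem exists_isLocalModel {θ : ∀ m : M, Covector d m} (hθ : IsSmoothForm θ) {f : M → ℝ}
    (hf : ContMDiff (𝓡 d) 𝓘(ℝ, ℝ) ∞ f) (m : M) : ∃ η g, IsLocalModel θ f m η g := by
  have hs : ContDiff ℝ ∞ fun x : Model d => x + extChartAt (𝓡 d) m m :=
    contDiff_id.add contDiff_const
  have ht : Tendsto (fun x : Model d => x + extChartAt (𝓡 d) m m) (𝓝 0)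
      (𝓝 (extChartAt (𝓡 d) m m)) := hs.continuous.tendsto' _ _ (zero_add _)
  have hev := ht.eventually (extChartAt_target_mem_nhds (I := 𝓡 d) m)
  obtain ⟨η, hη, hη'⟩ := exists_contDiff_eventuallyEq (a := (0 : Model d))
    (g := fun x => chartForm θ m (x + extChartAt (𝓡 d) m m)) (by
      filter_upwards [hev] with x hx
      exact (hθ.contDiffAt hx).comp x hs.contDiffAt)
  obtain ⟨g, hg, hg'⟩ := exists_contDiff_eventuallyEq (a := (0 : Model d))
    (g := fun x => f ((extChartAt (𝓡 d) m).symm (x + extChartAt (𝓡 d) m m))) (by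
      filter_upwards [hev] with x hx
      exact ContDiffAt.comp (g := f ∘ (extChartAt (𝓡 d) m).symm) x
        (contDiffAt_comp_extChartAt_symm hf hx) hs.contDiffAt)
  exact ⟨η, g, hη, hg, hη', hg'⟩

namespace IsLocalModel

variable {θ : ∀ m : M, Covector d m} {f : M → ℝ} {m : M} {η : Model d → Model d →L[ℝ] ℝ}
  {g : Model d → ℝ}

theorem eventually_eq (h : IsLocalModel θ f m η g) (hθ : IsSmoothForm θ)
    (hf : ContMDiff (𝓡 d) 𝓘(ℝ, ℝ) ∞ f) :
    ∀ᶠ q in 𝓝 m, q ∈ (extChartAt (𝓡 d) m).source ∧ ∀ v w : Model d,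
      θ q v = η (extChartAt (𝓡 d) m q - extChartAt (𝓡 d) m m) (coordChangeDeriv d m q v) ∧
      extDer θ q v w = extDerivForm η (extChartAt (𝓡 d) m q - extChartAt (𝓡 d) m m)
        (coordChangeDeriv d m q v) (coordChangeDeriv d m q w) ∧
      mvfderiv (𝓡 d) f q v = fderiv ℝ g (extChartAt (𝓡 d) m q - extChartAt (𝓡 d) m m)
        (coordChangeDeriv d m q v) := by
  filter_upwards [(tendsto_extChartAt_sub m).eventually h.form_eq.eventually_nhds,
    (tendsto_extChartAt_sub m).eventually h.fun_eq.eventually_nhds,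
    extChartAt_source_mem_nhds (I := 𝓡 d) m] with q h1 h2 hq
  refine ⟨hq, fun v w => ⟨?_, ?_, ?_⟩⟩
  · rw [form_eq_chartForm θ hq, h1.self_of_nhds, sub_add_cancel]
  · rw [extDer_eq_extDerivForm hθ hq, extDerivForm_congr h1]
    simp only [extDerivForm, fderiv_comp_add_right, sub_add_cancel]
  · rw [mvfderiv_eq_fderiv hf hq, EventuallyEq.fderiv_eq h2]
    have := fderiv_comp_add_right (𝕜 := ℝ) (f := f ∘ (extChartAt (𝓡 d) m).symm)
      (x := extChartAt (𝓡 d) m q - extChartAt (𝓡 d) m m) (extChartAt (𝓡 d) m m)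
    simp only [Function.comp_apply, sub_add_cancel] at this
    rw [this]

theorem eq_zero (h : IsLocalModel θ f m η g) (hθ : IsSmoothForm θ)
    (hf : ContMDiff (𝓡 d) 𝓘(ℝ, ℝ) ∞ f) (v w : Model d) :
    θ m v = η 0 v ∧ extDer θ m v w = extDerivForm η 0 v w ∧
      mvfderiv (𝓡 d) f m v = fderiv ℝ g 0 v := by
  have := (h.eventually_eq hθ hf).self_of_nhds.2 v w
  rw [sub_self, coordChangeDeriv_self] at this
  exact this

end IsLocalModel

end LocalModel

/-! ### Pointwise duality and closedness of the two conditions -/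

section Pointwise

variable {n : ℕ} {M : Type*} [TopologicalSpace M] [ChartedSpace (Model (2 * n + 1)) M]
  {θ : ∀ m : M, Covector (2 * n + 1) m} {D : ∀ m : M, Submodule ℝ (TangentSpace (𝓡 (2 * n + 1)) m)}
  {f : M → ℝ}

/-- The exterior derivative at a point, as a bilinear form. -/
noncomputable def extDerBilin (θ : ∀ m : M, Covector (2 * n + 1) m) (m : M) :
    LinearMap.BilinForm ℝ (TangentSpace (𝓡 (2 * n + 1)) m) :=
  LinearMap.mk₂ ℝ (fun v w => extDer θ m v w)
    (fun a b c => by simp) (fun a b c => by simp) (fun a b c => by simp) (fun a b c => by simp)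

theorem IsContactForm.isLinearContact (hθ : IsContactForm θ) (m : M) :
    IsLinearContact n (θ m).toLinearMap (extDerBilin θ m) where
  finrank_eq := by
    have : finrank ℝ (Model (2 * n + 1)) = 2 * n + 1 := by simp
    exact this
  ne_zero h := hθ.ne_zero m (ContinuousLinearMap.ext fun v => LinearMap.congr_fun h v)
  isAlt v := extDer_self θ m v
  nondegenerate := hθ.nondegenerate m

theorem IsContactForm.extDer_hamiltonianField (hθ : IsContactForm θ) (f : M → ℝ) {m : M}
    {v : TangentSpace (𝓡 (2 * n + 1)) m} (hv : v ∈ contactPlane θ m) :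
    extDer θ m (hamiltonianField θ f m) v = mvfderiv (𝓡 (2 * n + 1)) f m v := by
  have hv' : θ m v = 0 := hv
  rw [(hθ.isHamiltonianAt f m).2 v, hv', mul_zero, sub_zero]

theorem hamiltonianField_mem_orth_iff (hθ : IsContactForm θ) (hDC : ∀ m, D m ≤ contactPlane θ m)
    (m : M) : hamiltonianField θ f m ∈ orth θ D m ↔
      ∀ v ∈ D m, mvfderiv (𝓡 (2 * n + 1)) f m v = 0 := by
  have key : ∀ v ∈ D m, extDer θ m v (hamiltonianField θ f m) =
      -mvfderiv (𝓡 (2 * n + 1)) f m v := fun v hv => by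
    rw [extDer_swap, hθ.extDer_hamiltonianField f (hDC m hv)]
  constructor
  · intro h v hv
    have := h.2 v hv
    rwa [key v hv, neg_eq_zero] at this
  · intro h
    exact ⟨(hθ.isHamiltonianAt f m).1, fun w hw => by rw [key w hw, h w hw, neg_zero]⟩

/-- One direction is the definition of `orth`; the other is `D^⊥⊥ = D` inside the contact plane. -/
theorem hamiltonianField_mem_iff (hθ : IsContactForm θ) (hDC : ∀ m, D m ≤ contactPlane θ m)
    (m : M) : hamiltonianField θ f m ∈ D m ↔
      ∀ v ∈ orth θ D m, mvfderiv (𝓡 (2 * n + 1)) f m v = 0 := by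
  constructor
  · intro h v hv
    rw [← hθ.extDer_hamiltonianField f hv.1]
    exact hv.2 _ h
  · intro h
    refine (hθ.isLinearContact m).mem_of_orthogonal_orthogonal (hDC m)
      (hθ.isHamiltonianAt f m).1 fun w hw hwD => ?_
    change extDer θ m w (hamiltonianField θ f m) = 0
    rw [extDer_swap, hθ.extDer_hamiltonianField f hw, h w ⟨hw, hwD⟩, neg_zero]

variable [IsManifold (𝓡 (2 * n + 1)) ∞ M]

theorem IsLocalModel.isContactAt {m : M} {η : Model (2 * n + 1) → Model (2 * n + 1) →L[ℝ] ℝ}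
    {g : Model (2 * n + 1) → ℝ} (h : IsLocalModel θ f m η g) (hθ : IsContactForm θ)
    (hf : ContMDiff (𝓡 (2 * n + 1)) 𝓘(ℝ, ℝ) ∞ f) : IsContactAt η 0 := by
  have h0 := h.eq_zero hθ.smooth hf
  refine ⟨fun h => hθ.ne_zero m (ContinuousLinearMap.ext fun v => ?_), fun v hv hvw => ?_⟩
  · exact (h0 v v).1.trans (DFunLike.congr_fun h v)
  · exact hθ.nondegenerate m v ((h0 v v).1.trans hv) fun w hw =>
      (h0 v w).2.1.trans (hvw w ((h0 w w).1.symm.trans hw))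

theorem IsLocalModel.extDerivForm_hamiltonianField {m : M}
    {η : Model (2 * n + 1) → Model (2 * n + 1) →L[ℝ] ℝ} {g : Model (2 * n + 1) → ℝ}
    (h : IsLocalModel θ f m η g) (hθ : IsContactForm θ)
    (hf : ContMDiff (𝓡 (2 * n + 1)) 𝓘(ℝ, ℝ) ∞ f) (v : Model (2 * n + 1)) :
    extDerivForm η 0 (hamiltonianField θ f m) v =
      fderiv ℝ g 0 v - mvfderiv (𝓡 (2 * n + 1)) f m (reeb θ m) * η 0 v := by
  have h0 := h.eq_zero hθ.smooth hf
  exact (h0 (hamiltonianField θ f m) v).2.1.symm.trans (((hθ.isHamiltonianAt f m).2 v).trans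
    (congrArg₂ (fun a b => a - mvfderiv (𝓡 (2 * n + 1)) f m (reeb θ m) * b)
      (h0 v v).2.2 (h0 v v).1))

theorem IsDistribution.finrank_eq {k : ℕ} (hD : IsDistribution k D) (m : M) :
    finrank ℝ (D m) = k := by
  obtain ⟨U, -, hm, X, -, hX⟩ := hD m
  rw [(hX m hm).2, finrank_span_eq_card (hX m hm).1, Fintype.card_fin]

/-- If `df` does not kill `D` at `m`, it is nonzero on some frame field there, and by continuity
also nearby. -/
theorem isClosed_setOf_forall_mvfderiv_eq_zero {k : ℕ} (hθ : IsContactForm θ)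
    (hD : IsDistribution k D) (hf : ContMDiff (𝓡 (2 * n + 1)) 𝓘(ℝ, ℝ) ∞ f) :
    IsClosed {m : M | ∀ v ∈ D m, mvfderiv (𝓡 (2 * n + 1)) f m v = 0} := by
  rw [← isOpen_compl_iff, isOpen_iff_eventually]
  intro m hm
  obtain ⟨U, hU, hmU, X, hXs, hX⟩ := hD m
  obtain ⟨η, g, hloc⟩ := exists_isLocalModel hθ.smooth hf m
  have hi : ∃ i, mvfderiv (𝓡 (2 * n + 1)) f m (X i m) ≠ 0 := by
    by_contra hcon
    push Not at hcon
    refine hm fun v hv => ?_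
    rw [(hX m hmU).2] at hv
    induction hv using Submodule.span_induction with
    | mem x hx => obtain ⟨i, rfl⟩ := hx; exact hcon i
    | zero => exact map_zero _
    | add x y _ _ hx hy => rw [map_add, hx, hy, add_zero]
    | smul c x _ hx => rw [map_smul, hx, smul_zero]
  obtain ⟨i, hi⟩ := hi
  have hcont : ContinuousAt (fun q => fderiv ℝ g
      (extChartAt (𝓡 (2 * n + 1)) m q - extChartAt (𝓡 (2 * n + 1)) m m)
      (coordChangeDeriv (2 * n + 1) m q (X i q))) m := by
    refine ContinuousAt.clm_apply ?_ (continuousAt_coordChangeDeriv_section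
      ((hXs i).contMDiffAt (hU.mem_nhds hmU)))
    refine (hloc.contDiff_fun.continuous_fderiv (by simp)).continuousAt.comp ?_
    exact (continuousAt_extChartAt (I := 𝓡 (2 * n + 1)) m).sub_const _
  have hev := hloc.eventually_eq hθ.smooth hf
  have hne := hcont.eventually_ne (y := 0) (by
    rw [← (hev.self_of_nhds.2 (X i m) (X i m)).2.2]; exact hi)
  filter_upwards [hev, hne, hU.mem_nhds hmU] with q h1 h2 hq hcon
  refine h2 ?_
  rw [← (h1.2 (X i q) (X i q)).2.2]
  exact hcon _ (by rw [(hX q hq).2]; exact Submodule.subset_span ⟨i, rfl⟩)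

/-- This gives closedness of `df|_{D^⊥} = 0` without constructing a smooth frame of `D^⊥`: where
`Y_f ∉ D`, the field and a frame of `D` are linearly independent, which is an open condition. -/
theorem isClosed_setOf_hamiltonianField_mem {k : ℕ} (hθ : IsContactForm θ)
    (hD : IsDistribution k D) (hf : ContMDiff (𝓡 (2 * n + 1)) 𝓘(ℝ, ℝ) ∞ f) :
    IsClosed {m : M | hamiltonianField θ f m ∈ D m} := by
  rw [← isOpen_compl_iff, isOpen_iff_eventually]
  intro m hm
  obtain ⟨U, hU, hmU, X, hXs, hX⟩ := hD m
  obtain ⟨η, g, hloc⟩ := exists_isLocalModel hθ.smooth hf m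
  have hev := hloc.eventually_eq hθ.smooth hf
  obtain ⟨Y, h, hY, -, hYm, hYH⟩ := (hloc.isContactAt hθ hf).exists_hamiltonian
    hloc.contDiff_form hloc.contDiff_fun
    ((hloc.eq_zero hθ.smooth hf (hamiltonianField θ f m) 0).1.symm.trans (hθ.isHamiltonianAt f m).1)
    (hloc.extDerivForm_hamiltonianField hθ hf)
  have ht := tendsto_extChartAt_sub (d := 2 * n + 1) m
  have hcont : ContinuousAt (fun q => (Fin.cons
      (Y (extChartAt (𝓡 (2 * n + 1)) m q - extChartAt (𝓡 (2 * n + 1)) m m))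
      fun i => coordChangeDeriv (2 * n + 1) m q (X i q) : Fin (k + 1) → Model (2 * n + 1))) m := by
    refine continuousAt_pi.2 fun i => ?_
    refine Fin.cases ?_ (fun i => ?_) i
    · simp only [Fin.cons_zero]
      exact hY.continuous.continuousAt.comp
        ((continuousAt_extChartAt (I := 𝓡 (2 * n + 1)) m).sub_const _)
    · simp only [Fin.cons_succ]
      exact continuousAt_coordChangeDeriv_section ((hXs i).contMDiffAt (hU.mem_nhds hmU))
  have hind := hcont.eventually (isOpen_setOfPred_linearIndependent.mem_nhds (by
    simp only [Set.mem_ofPred_eq, sub_self, hYm, coordChangeDeriv_self]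
    refine linearIndependent_finCons.2 ⟨(hX m hmU).1, ?_⟩
    intro hmem
    refine hm ?_
    change hamiltonianField θ f m ∈ D m
    rw [(hX m hmU).2]
    exact hmem))
  filter_upwards [hev, hind, ht.eventually hYH, hU.mem_nhds hmU] with q hq hq2 hq3 hqU hcon
  -- The smooth local solution `Y` agrees with `Y_f` in coordinates, by uniqueness of the
  -- Hamiltonian vector.
  have hYq : coordChangeDeriv (2 * n + 1) m q (hamiltonianField θ f q) =
      Y (extChartAt (𝓡 (2 * n + 1)) m q - extChartAt (𝓡 (2 * n + 1)) m m) := by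
    obtain ⟨y, hy⟩ : ∃ y : TangentSpace (𝓡 (2 * n + 1)) q, coordChangeDeriv (2 * n + 1) m q y =
        Y (extChartAt (𝓡 (2 * n + 1)) m q - extChartAt (𝓡 (2 * n + 1)) m m) :=
      coordChangeDeriv_surjective hq.1 _
    rw [← hy] at hq3 ⊢
    have hyc : y ∈ contactPlane θ q := ((hq.2 y y).1).trans hq3.1
    have hsub := hθ.nondegenerate q (hamiltonianField θ f q - y)
      (Submodule.sub_mem _ (hθ.isHamiltonianAt f q).1 hyc) fun w hw => by
        have hw' : θ q w = 0 := hw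
        have e1 := (hq.2 y w).2.1
        rw [hq3.2, ← (hq.2 w w).1, hw', mul_zero, sub_zero, ← (hq.2 w w).2.2] at e1
        rw [map_sub]
        refine sub_eq_zero.2 ?_
        exact (hθ.extDer_hamiltonianField f hw).trans e1.symm
    exact congrArg _ (sub_eq_zero.1 hsub)
  refine (linearIndependent_finCons.1 hq2).2 ?_
  rw [← hYq]
  have hcon' : hamiltonianField θ f q ∈ D q := hcon
  rw [(hX q hqU).2] at hcon'
  refine Submodule.span_induction (p := fun (v : TangentSpace (𝓡 (2 * n + 1)) q) _ =>
    coordChangeDeriv (2 * n + 1) m q v ∈ Submodule.span ℝ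
      (Set.range fun i => coordChangeDeriv (2 * n + 1) m q (X i q))) ?_ ?_ ?_ ?_ hcon'
  · rintro _ ⟨i, rfl⟩
    exact Submodule.subset_span ⟨i, rfl⟩
  · exact (congrArg (· ∈ _) (map_zero (coordChangeDeriv (2 * n + 1) m q))).mpr
      (Submodule.zero_mem _)
  · intro v w _ _ hv hw
    exact (congrArg (· ∈ _) (map_add (coordChangeDeriv (2 * n + 1) m q) v w)).mpr
      (Submodule.add_mem _ hv hw)
  · intro c v _ hv
    exact (congrArg (· ∈ _) (map_smul (coordChangeDeriv (2 * n + 1) m q) c v)).mpr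
      (Submodule.smul_mem _ c hv)

end Pointwise

end ContactGeometry

namespace ContactGeometry
open Filter Module

/-! ### The pointwise alternative gives an intermediate integral -/

section Sufficiency

variable {d k n : ℕ}

/-- The exterior derivative commutes with pullback, so `j^*θ = 0` near `x` forces `j^*dθ = 0` at
`x`. -/
theorem extDer_mfderiv_eq_zero {M : Type*} [TopologicalSpace M] [ChartedSpace (Model d) M]
    [IsManifold (𝓡 d) ∞ M] {θ : ∀ m : M, Covector d m} (hθ : IsSmoothForm θ) {j : Model k → M}
    {x : Model k} (hj : ∀ᶠ y in 𝓝 x, ContMDiffAt (𝓡 k) (𝓡 d) ∞ j y)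
    (h : ∀ᶠ y in 𝓝 x, ∀ v, θ (j y) (mfderiv (𝓡 k) (𝓡 d) j y v) = 0) (v w : Model k) :
    extDer θ (j x) (mfderiv (𝓡 k) (𝓡 d) j x v) (mfderiv (𝓡 k) (𝓡 d) j x w) = 0 := by
  have hjx := hj.self_of_nhds
  have hsrc := mem_extChartAt_source (I := 𝓡 d) (j x)
  have h0 : pullbackForm (extChartAt (𝓡 d) (j x) ∘ j) (chartForm θ (j x)) =ᶠ[𝓝 x] 0 := by
    filter_upwards [hj, h,
      hjx.continuousAt ((isOpen_extChartAt_source (j x)).mem_nhds hsrc)] with y h1 h2 h3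
    exact ContinuousLinearMap.ext fun v =>
      (form_mfderiv_eq_pullbackForm θ h3 h1 v).symm.trans (h2 v)
  have h1 := extDerivForm_pullbackForm (θ := chartForm θ (j x)) (contDiffAt_extChartAt_comp hsrc hjx)
    ((hθ.contDiffAt ((extChartAt (𝓡 d) (j x)).map_source hsrc)).differentiableAt (by simp)) v w
  rw [extDerivForm_congr h0] at h1
  have hm := hjx.mdifferentiableAt (by simp)
  have h2 : extDerivForm (0 : Model k → Model k →L[ℝ] ℝ) x v w = 0 := by
    rw [extDerivForm_apply]
    simp
  refine Eq.trans ?_ (h1.symm.trans h2)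
  exact congrArg₂ (fun a b => extDerivForm (chartForm θ (j x)) (extChartAt (𝓡 d) (j x) (j x)) a b)
    (mfderiv_apply_eq_fderiv rfl hm v) (mfderiv_apply_eq_fderiv rfl hm w)

theorem mvfderiv_mfderiv_eq_zero {M : Type*} [TopologicalSpace M] [ChartedSpace (Model d) M]
    [IsManifold (𝓡 d) ∞ M] {f : M → ℝ} (hf : ContMDiff (𝓡 d) 𝓘(ℝ, ℝ) ∞ f) {j : Model k → M}
    {x : Model k} (hj : ContMDiffAt (𝓡 k) (𝓡 d) ∞ j x) {c : ℝ} (h : ∀ᶠ y in 𝓝 x, f (j y) = c)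
    (v : Model k) : mvfderiv (𝓡 d) f (j x) (mfderiv (𝓡 k) (𝓡 d) j x v) = 0 := by
  have hsrc := mem_extChartAt_source (I := 𝓡 d) (j x)
  refine (mvfderiv_eq_fderiv hf hsrc _).trans ?_
  rw [coordChangeDeriv_self]
  refine (congrArg _ (mfderiv_apply_eq_fderiv rfl (hj.mdifferentiableAt (by simp)) v)).trans ?_
  refine fderiv_apply_of_eventuallyEq_const (c := c) (J := extChartAt (𝓡 d) (j x) ∘ j)
    ((contDiffAt_extChartAt_comp hsrc hj).differentiableAt (by simp))
    ((contDiffAt_comp_extChartAt_symm hf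
      ((extChartAt (𝓡 d) (j x)).map_source hsrc)).differentiableAt (by simp)) ?_ v
  filter_upwards [h, eventuallyEq_extChartAt_symm_comp hsrc hj.continuousAt] with y h1 h2
  exact (congrArg f h2.symm).trans h1

variable {M : Type*} [TopologicalSpace M] [ChartedSpace (Model (2 * n + 1)) M]
  {θ : ∀ m : M, Covector (2 * n + 1) m} {D : ∀ m : M, Submodule ℝ (TangentSpace (𝓡 (2 * n + 1)) m)}
  {f : M → ℝ} [IsManifold (𝓡 (2 * n + 1)) ∞ M]

theorem IsLagrangianSubmanifold.tangentPlanes_subset_prolongation (hθ : IsContactForm θ) {S : Set M}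
    (hS : IsLagrangianSubmanifold θ S) : tangentPlanes (2 * n + 1) n S ⊆ prolongation θ := by
  intro P hP
  refine ⟨hS.2 P hP, ?_⟩
  obtain ⟨W, j, hj, x, hx, rfl⟩ := hP
  refine ⟨(LinearMap.finrank_range_of_inj (hj.immersion x hx)).trans
    (finrank_euclideanSpace_fin (𝕜 := ℝ) (n := n)), ?_⟩
  have hW : ∀ᶠ y in 𝓝 x, y ∈ W := hj.isOpen.mem_nhds hx
  rintro _ ⟨v, rfl⟩ _ ⟨w, rfl⟩
  refine extDer_mfderiv_eq_zero hθ.smooth ?_ ?_ v w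
  · filter_upwards [hW] with y hy
    exact hj.contMDiffOn.contMDiffAt (hj.isOpen.mem_nhds hy)
  · filter_upwards [hW] with y hy v
    exact hS.2 _ ⟨W, j, hj, y, hy, rfl⟩ ⟨v, rfl⟩

theorem isIntermediateIntegral_of_hamiltonianField_mem (hθ : IsContactForm θ)
    (hD : IsDistribution n D) (hDC : ∀ m, D m ≤ contactPlane θ m)
    (hf : ContMDiff (𝓡 (2 * n + 1)) 𝓘(ℝ, ℝ) ∞ f) (hY : ∀ m, hamiltonianField θ f m ≠ 0)
    (h : ∀ m, hamiltonianField θ f m ∈ D m ∨ hamiltonianField θ f m ∈ orth θ D m) :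
    IsIntermediateIntegral θ (goursatEquation θ D) f := by
  rintro c S ⟨hS, hfS⟩
  refine ⟨hS, fun P hP => ?_⟩
  have hPp := hS.tangentPlanes_subset_prolongation hθ hP
  refine ⟨hPp, ?_⟩
  obtain ⟨hPC, hPn, hPi⟩ := hPp
  have hlin := hθ.isLinearContact P.1
  have hYP : hamiltonianField θ f P.1 ∈ P.2 := by
    refine hlin.mem_of_lagrangian hPC hPn hPi (hθ.isHamiltonianAt f P.1).1 fun v hv => ?_
    change extDer θ P.1 v _ = 0
    rw [extDer_swap, hθ.extDer_hamiltonianField f (hPC hv), neg_eq_zero]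
    obtain ⟨W, j, hj, x, hx, rfl⟩ := hP
    obtain ⟨v, rfl⟩ := hv
    refine mvfderiv_mfderiv_eq_zero (c := c) hf
      (hj.contMDiffOn.contMDiffAt (hj.isOpen.mem_nhds hx)) ?_ v
    filter_upwards [hj.isOpen.mem_nhds hx] with y hy
    obtain ⟨O, -, hO⟩ := hj.image_eq
    exact sub_eq_zero.1 (hfS _ (hO.subset (Set.mem_image_of_mem j hy)).1)
  rcases h P.1 with h | h
  · exact fun hbot => hY P.1 ((Submodule.eq_bot_iff _).1 hbot _ ⟨hYP, h⟩)
  · exact hlin.inf_ne_bot hPC hPn hPi (hDC P.1) (hD.finrank_eq P.1) (hY P.1) hYP h.2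

end Sufficiency

end ContactGeometry

namespace ContactGeometry
open Filter Module

/-! ### Submanifolds given as graphs in a chart -/

section GraphParametrization

variable {d k : ℕ} {M : Type*} [TopologicalSpace M] [ChartedSpace (Model d) M]

/-- `J` parametrizes, in the preferred chart at `x₀`, a submanifold which is a graph over the open
set `W`: it has the smooth left inverse `p`. -/
structure IsGraphParametrization (x₀ : M) (W : Set (Model k)) (J : Model k → Model d)
    (p : Model d → Model k) : Prop where
  isOpen : IsOpen W
  contDiff : ContDiff ℝ ∞ J
  contDiff_left : ContDiff ℝ ∞ p
  mapsTo : ∀ y ∈ W, J y ∈ (extChartAt (𝓡 d) x₀).target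
  left_inv : ∀ y ∈ W, p (J y) = y

namespace IsGraphParametrization

variable {x₀ : M} {W : Set (Model k)} {J : Model k → Model d} {p : Model d → Model k}

theorem extChartAt_symm_mem (h : IsGraphParametrization x₀ W J p) {y : Model k} (hy : y ∈ W) :
    (extChartAt (𝓡 d) x₀).symm (J y) ∈ (extChartAt (𝓡 d) x₀).source :=
  (extChartAt (𝓡 d) x₀).map_target (h.mapsTo y hy)

theorem left_inv_extChartAt (h : IsGraphParametrization x₀ W J p) {y : Model k} (hy : y ∈ W) :
    p (extChartAt (𝓡 d) x₀ ((extChartAt (𝓡 d) x₀).symm (J y))) = y := by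
  rw [(extChartAt (𝓡 d) x₀).right_inv (h.mapsTo y hy), h.left_inv y hy]

variable [IsManifold (𝓡 d) ∞ M]

theorem contMDiffAt (h : IsGraphParametrization x₀ W J p) {y : Model k} (hy : y ∈ W) :
    ContMDiffAt (𝓡 k) (𝓡 d) ∞ ((extChartAt (𝓡 d) x₀).symm ∘ J) y :=
  (contMDiffAt_extChartAt_symm' (h.mapsTo y hy)).comp y h.contDiff.contDiffAt.contMDiffAt

/-- The left inverse `p` gives injectivity of the differential by the chain rule and the embedding
property by continuity. -/
theorem isLocalParametrization (h : IsGraphParametrization x₀ W J p) :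
    IsLocalParametrization d ((extChartAt (𝓡 d) x₀).symm ∘ J '' W) W
      ((extChartAt (𝓡 d) x₀).symm ∘ J) where
  isOpen := h.isOpen
  contMDiffOn y hy := (h.contMDiffAt hy).contMDiffWithinAt
  immersion x hx := by
    have hr : MDifferentiableAt (𝓡 d) (𝓡 k) (p ∘ extChartAt (𝓡 d) x₀)
        (((extChartAt (𝓡 d) x₀).symm ∘ J) x) :=
      (h.contDiff_left.contDiffAt.contMDiffAt.comp _
        (contMDiffAt_extChartAt_of_mem (h.extChartAt_symm_mem hx))).mdifferentiableAt (by simp)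
    have h1 := mfderiv_comp x hr ((h.contMDiffAt hx).mdifferentiableAt (by simp))
    have h2 : (p ∘ extChartAt (𝓡 d) x₀) ∘ ((extChartAt (𝓡 d) x₀).symm ∘ J) =ᶠ[𝓝 x] id := by
      filter_upwards [h.isOpen.mem_nhds hx] with y hy
      exact h.left_inv_extChartAt hy
    have h3 : ∀ v : Model k, mfderiv (𝓡 k) (𝓡 k)
        ((p ∘ extChartAt (𝓡 d) x₀) ∘ ((extChartAt (𝓡 d) x₀).symm ∘ J)) x v = v := fun v => by
      refine (DFunLike.congr_fun (h2.mfderiv_eq (I := 𝓡 k) (I' := 𝓡 k)) v).trans ?_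
      exact DFunLike.congr_fun (mfderiv_id (I := 𝓡 k) (x := x)) v
    intro v w hvw
    refine (h3 v).symm.trans (Eq.trans ?_ (h3 w))
    refine (DFunLike.congr_fun h1 v).trans (Eq.trans ?_ (DFunLike.congr_fun h1 w).symm)
    exact congrArg (mfderiv (𝓡 d) (𝓡 k) (p ∘ extChartAt (𝓡 d) x₀) _) hvw
  isEmbedding := by
    let i : W → (extChartAt (𝓡 d) x₀).source := fun y =>
      ⟨(extChartAt (𝓡 d) x₀).symm (J y), h.extChartAt_symm_mem y.2⟩
    let r : (extChartAt (𝓡 d) x₀).source → Model k := fun q => p (extChartAt (𝓡 d) x₀ q)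
    have hi : Continuous i := by
      refine Continuous.subtype_mk ?_ _
      exact continuousOn_iff_continuous_domRestrict.1 fun y hy =>
        (h.contMDiffAt hy).continuousAt.continuousWithinAt
    have hr : Continuous r := h.contDiff_left.continuous.comp
      (continuousOn_iff_continuous_domRestrict.1 (continuousOn_extChartAt x₀))
    have hri : r ∘ i = Subtype.val := funext fun y => h.left_inv_extChartAt y.2
    have hie : Topology.IsEmbedding i :=
      Topology.IsEmbedding.of_comp hi hr (hri ▸ Topology.IsEmbedding.subtypeVal)
    exact Topology.IsEmbedding.subtypeVal.comp hie
  image_eq := ⟨Set.univ, isOpen_univ, (Set.inter_univ _).symm⟩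

/-- Tangency is required for every parametrization `j` of the image. Through the left inverse, `j`
factors smoothly as `J` composed with `p ∘ φ ∘ j` in the chart `φ`, so the vanishing of `J^*θ`
passes to it. -/
theorem form_mfderiv_eq_zero (h : IsGraphParametrization x₀ W J p) {θ : ∀ m : M, Covector d m}
    (hJ : ∀ y ∈ W, pullbackForm J (chartForm θ x₀) y = 0) {W' : Set (Model k)} {j : Model k → M}
    (hj : IsLocalParametrization d ((extChartAt (𝓡 d) x₀).symm ∘ J '' W) W' j) {x : Model k}
    (hx : x ∈ W') (v : Model k) : θ (j x) (mfderiv (𝓡 k) (𝓡 d) j x v) = 0 := by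
  have hsub : ∀ y ∈ W', ∃ z ∈ W, (extChartAt (𝓡 d) x₀).symm (J z) = j y := fun y hy => by
    obtain ⟨O, -, hO⟩ := hj.image_eq
    exact (hO.subset (Set.mem_image_of_mem j hy)).1
  have hjW : ∀ y ∈ W', (extChartAt (𝓡 d) x₀ ∘ j) y = J (p (extChartAt (𝓡 d) x₀ (j y))) ∧
      p (extChartAt (𝓡 d) x₀ (j y)) ∈ W ∧ j y ∈ (extChartAt (𝓡 d) x₀).source := fun y hy => by
    obtain ⟨z, hz, hzy⟩ := hsub y hy
    rw [Function.comp_apply, ← hzy, h.left_inv_extChartAt hz,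
      (extChartAt (𝓡 d) x₀).right_inv (h.mapsTo z hz)]
    exact ⟨rfl, hz, h.extChartAt_symm_mem hz⟩
  obtain ⟨h1, h2, h3⟩ := hjW x hx
  have hjx := hj.contMDiffOn.contMDiffAt (hj.isOpen.mem_nhds hx)
  have hev : extChartAt (𝓡 d) x₀ ∘ j =ᶠ[𝓝 x] J ∘ (p ∘ (extChartAt (𝓡 d) x₀ ∘ j)) := by
    filter_upwards [hj.isOpen.mem_nhds hx] with y hy
    exact (hjW y hy).1
  have hd : DifferentiableAt ℝ (p ∘ (extChartAt (𝓡 d) x₀ ∘ j)) x :=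
    (h.contDiff_left.contDiffAt.comp x (contDiffAt_extChartAt_comp h3 hjx)).differentiableAt
      (by simp)
  rw [form_mfderiv_eq_pullbackForm θ h3 hjx, pullbackForm_apply, hev.fderiv_eq,
    fderiv_comp x ((h.contDiff.differentiable (by simp)) _) hd, h1]
  have := DFunLike.congr_fun (hJ _ h2) (fderiv ℝ (p ∘ (extChartAt (𝓡 d) x₀ ∘ j)) x v)
  rw [pullbackForm_apply] at this
  exact this

end IsGraphParametrization

theorem sigma_mk_eq_of_forall_mem_iff {m m' : M} (h : m' = m)
    {R : Submodule ℝ (TangentSpace (𝓡 d) m')} {L : Submodule ℝ (TangentSpace (𝓡 d) m)}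
    (hRL : ∀ v : Model d, (v : TangentSpace (𝓡 d) m') ∈ R ↔ (v : TangentSpace (𝓡 d) m) ∈ L) :
    (⟨m, L⟩ : Σ m : M, Submodule ℝ (TangentSpace (𝓡 d) m)) = ⟨m', R⟩ := by
  subst h
  exact congrArg (Sigma.mk m') (Submodule.ext fun v => (hRL v).symm)

end GraphParametrization

/-! ### Realising Lagrangian planes by solutions -/

section Necessity

variable {n : ℕ} {M : Type*} [TopologicalSpace M] [ChartedSpace (Model (2 * n + 1)) M]
  {θ : ∀ m : M, Covector (2 * n + 1) m} {D : ∀ m : M, Submodule ℝ (TangentSpace (𝓡 (2 * n + 1)) m)}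
  {f : M → ℝ} [IsManifold (𝓡 (2 * n + 1)) ∞ M]

/-- Every Lagrangian plane which contains the Hamiltonian vector of `f` is tangent to a Lagrangian
submanifold on which `f` is constant. -/
theorem exists_solution_of_mem_prolongation (hθ : IsContactForm θ)
    (hf : ContMDiff (𝓡 (2 * n + 1)) 𝓘(ℝ, ℝ) ∞ f) {m : M} (hY : hamiltonianField θ f m ≠ 0)
    {L : Submodule ℝ (TangentSpace (𝓡 (2 * n + 1)) m)}
    (hL : (⟨m, L⟩ : Σ m : M, Submodule ℝ (TangentSpace (𝓡 (2 * n + 1)) m)) ∈ prolongation θ)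
    (hYL : hamiltonianField θ f m ∈ L) :
    ∃ S, IsSolutionOfFirstOrder θ (fun q => f q - f m) S ∧
      (⟨m, L⟩ : Σ m : M, Submodule ℝ (TangentSpace (𝓡 (2 * n + 1)) m)) ∈
        tangentPlanes (2 * n + 1) n S := by
  obtain ⟨η, g, hloc⟩ := exists_isLocalModel hθ.smooth hf m
  obtain ⟨hLC, hLn, hLi⟩ := hL
  have h0 := hloc.eq_zero hθ.smooth hf
  let L' : Submodule ℝ (Model (2 * n + 1)) := L
  have hL' : IsIsotropicAt η 0 L' :=
    ⟨fun v hv => (h0 v v).1.symm.trans (hLC hv),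
      fun v hv w hw => (h0 v w).2.1.symm.trans (hLi v hv w hw)⟩
  obtain ⟨j, p, hj, hfj, hpj⟩ := exists_integralGerm_levelSet_graph (hloc.isContactAt hθ hf)
    hloc.contDiff_form hloc.contDiff_fun hL' (Y₀ := hamiltonianField θ f m) hYL hY
    (hloc.extDerivForm_hamiltonianField hθ hf)
  have hLn' : finrank ℝ L' = n := hLn
  let e : Model n ≃L[ℝ] L' := ContinuousLinearEquiv.ofFinrankEq (by simp [hLn'])
  let b : Model (2 * n + 1) := extChartAt (𝓡 (2 * n + 1)) m m
  have hje : ContDiff ℝ ∞ (j ∘ e) := hj.contDiff.comp e.contDiff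
  have hte : Tendsto e (𝓝 0) (𝓝 0) := e.continuous.tendsto' _ _ (map_zero e)
  have htj : Tendsto (j ∘ e) (𝓝 0) (𝓝 0) :=
    hje.continuous.tendsto' _ _ (by simp [hj.map_zero])
  have htb : Tendsto (fun y => j (e y) + b) (𝓝 0) (𝓝 b) :=
    (hje.add contDiff_const).continuous.tendsto' _ _ (by simp [hj.map_zero])
  -- One open `W` on which all the germ identities hold at once.
  obtain ⟨W, hW, hWo, hW0⟩ := eventually_nhds_iff.1
    ((htj.eventually hloc.form_eq).and ((htj.eventually hloc.fun_eq).and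
      ((hte.eventually hj.pullback).and ((hte.eventually hfj).and ((hte.eventually hpj).and
        (htb.eventually (extChartAt_target_mem_nhds (I := 𝓡 (2 * n + 1)) m)))))))
  have hG : IsGraphParametrization m W (fun y => j (e y) + b) fun x => e.symm (p (x - b)) := by
    refine ⟨hWo, hje.add contDiff_const,
      e.symm.contDiff.comp (p.contDiff.comp (contDiff_id.sub contDiff_const)),
      fun y hy => (hW y hy).2.2.2.2.2, fun y hy => ?_⟩
    simp only [add_sub_cancel_right, (hW y hy).2.2.2.2.1, e.symm_apply_apply]
  have hfd : ∀ y v, fderiv ℝ (fun y => j (e y) + b) y v = fderiv ℝ j (e y) (e v) := fun y v => by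
    have h1 : HasFDerivAt (fun y => j (e y) + b)
        ((fderiv ℝ j (e y)).comp (e : Model n →L[ℝ] L')) y :=
      (((hj.contDiff.differentiable (by simp)) (e y)).hasFDerivAt.comp y e.hasFDerivAt).add_const b
    rw [h1.fderiv]
    rfl
  have hpull : ∀ y ∈ W, pullbackForm (fun y => j (e y) + b) (chartForm θ m) y = 0 :=
    fun y hy => ContinuousLinearMap.ext fun v => by
      obtain ⟨h1, -, h2, -⟩ := hW y hy
      have h3 := DFunLike.congr_fun h2 (e v)
      rw [pullbackForm_apply] at h3
      rw [pullbackForm_apply, hfd]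
      exact (congrArg (fun α : Model (2 * n + 1) →L[ℝ] ℝ => α (fderiv ℝ j (e y) (e v)))
        h1).symm.trans h3
  have hzero : ((extChartAt (𝓡 (2 * n + 1)) m).symm ∘ fun y => j (e y) + b) 0 = m := by
    simp [hj.map_zero, b]
  refine ⟨_, ⟨⟨fun q hq => ⟨W, _, hG.isLocalParametrization, hq⟩, ?_⟩, ?_⟩,
    W, _, hG.isLocalParametrization, 0, hW0, ?_⟩
  · rintro P ⟨W', i, hi, x, hx, rfl⟩ _ ⟨v, rfl⟩
    exact hG.form_mfderiv_eq_zero hpull hi hx v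
  · rintro _ ⟨y, hy, rfl⟩
    obtain ⟨-, h1, -, h2, -⟩ := hW y hy
    have h3 := hloc.fun_eq.self_of_nhds
    rw [zero_add, extChartAt_to_inv] at h3
    exact sub_eq_zero.2 (h1.symm.trans (h2.trans h3))
  · refine sigma_mk_eq_of_forall_mem_iff hzero fun v => ?_
    have hev : extChartAt (𝓡 (2 * n + 1)) m ∘
        ((extChartAt (𝓡 (2 * n + 1)) m).symm ∘ fun y => j (e y) + b) =ᶠ[𝓝 0]
        fun y => j (e y) + b := by
      filter_upwards [hWo.mem_nhds hW0] with y hy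
      exact (extChartAt (𝓡 (2 * n + 1)) m).right_inv (hG.mapsTo y hy)
    have hmf : ∀ u : Model n, (mfderiv (𝓡 n) (𝓡 (2 * n + 1))
        ((extChartAt (𝓡 (2 * n + 1)) m).symm ∘ fun y => j (e y) + b) 0 u : Model (2 * n + 1)) =
        (e u : L').1 := fun u => by
      refine (mfderiv_apply_eq_fderiv hzero
        ((hG.contMDiffAt hW0).mdifferentiableAt (by simp)) u).trans ?_
      rw [hev.fderiv_eq, hfd, map_zero, hj.hasFDerivAt.fderiv]
      rfl
    constructor
    · rintro ⟨u, hu⟩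
      exact ((hmf u).symm.trans hu) ▸ (e u).2
    · intro hv
      exact ⟨e.symm ⟨v, hv⟩, (hmf _).trans (congrArg Subtype.val (e.apply_symm_apply ⟨v, hv⟩))⟩

/-- No global hypothesis on zeros of `Y_f` is needed: where the alternative fails, `Y_f ∉ D` already
makes it nonzero. -/
theorem IsIntermediateIntegral.hamiltonianField_mem (hθ : IsContactForm θ)
    (hD : IsDistribution n D) (hDC : ∀ m, D m ≤ contactPlane θ m)
    (hf : ContMDiff (𝓡 (2 * n + 1)) 𝓘(ℝ, ℝ) ∞ f)
    (h : IsIntermediateIntegral θ (goursatEquation θ D) f) (m : M) :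
    hamiltonianField θ f m ∈ D m ∨ hamiltonianField θ f m ∈ orth θ D m := by
  by_contra! hcon
  obtain ⟨hYD, hYO⟩ := hcon
  have hYC := (hθ.isHamiltonianAt f m).1
  obtain ⟨L, hLC, hYL, hLn, hLi, hLD⟩ := (hθ.isLinearContact m).exists_lagrangian (hDC m)
    (hD.finrank_eq m) hYC hYD fun hw => hYO ⟨hYC, hw⟩
  obtain ⟨S, hS, hLS⟩ := exists_solution_of_mem_prolongation hθ hf
    (fun h0 => hYD (h0 ▸ Submodule.zero_mem _)) ⟨hLC, hLn, hLi⟩ hYL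
  exact ((h _ S hS).2 hLS).2 hLD

end Necessity

end ContactGeometry

/-! ### Topology of the two closed sets and the main theorem -/

namespace ContactGeometry

theorem dense_interior_union_interior {X : Type*} [TopologicalSpace X] {A B : Set X}
    (hA : IsClosed A) (hAB : A ∪ B = Set.univ) :
    Dense (interior A ∪ interior B) := by
  have hcA : Aᶜ ⊆ interior B := interior_maximal
    (fun y hy => (hAB.superset (Set.mem_univ y)).resolve_left hy) hA.isOpen_compl
  -- This union is the complement of the frontier of `A`, and the frontier of a closed set has empty
  -- interior.
  have hd : Dense (interior A ∪ Aᶜ) := by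
    have h := interior_frontier hA
    rw [interior_eq_empty_iff_dense_compl, hA.frontier_eq, Set.compl_sdiff] at h
    exact h
  exact hd.mono (Set.union_subset_union_right _ hcA)

end ContactGeometry

open ContactGeometry

theorem mainTheorem9 {n : ℕ} {M : Type*} [TopologicalSpace M]
    [ChartedSpace (Model (2 * n + 1)) M] [IsManifold (𝓡 (2 * n + 1)) ∞ M]
    (θ : ∀ m : M, Covector (2 * n + 1) m) (hθ : IsContactForm θ)
    (D : ∀ m : M, Submodule ℝ (TangentSpace (𝓡 (2 * n + 1)) m))
    (hD : IsDistribution n D) (hDC : ∀ m, D m ≤ contactPlane θ m)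
    (f : M → ℝ) (hf : ContMDiff (𝓡 (2 * n + 1)) 𝓘(ℝ, ℝ) ∞ f) :
    -- necessity, for every smooth function
    (IsIntermediateIntegral θ (goursatEquation θ D) f →
      ∀ m, hamiltonianField θ f m ∈ D m ∨ hamiltonianField θ f m ∈ orth θ D m) ∧
    -- the characterizations, for functions whose Hamiltonian field has no zeros
    ((∀ m, hamiltonianField θ f m ≠ 0) →
      (IsIntermediateIntegral θ (goursatEquation θ D) f ↔
        ∀ m, hamiltonianField θ f m ∈ D m ∨ hamiltonianField θ f m ∈ orth θ D m) ∧
      (IsIntermediateIntegral θ (goursatEquation θ D) f ↔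
        ∀ m, (∀ v ∈ D m, mvfderiv (𝓡 (2 * n + 1)) f m v = 0) ∨
          (∀ v ∈ orth θ D m, mvfderiv (𝓡 (2 * n + 1)) f m v = 0)) ∧
      (IsIntermediateIntegral θ (goursatEquation θ D) f ↔
        ∃ U : Set M, Dense U ∧ ∀ p ∈ U, ∃ O : Set M, IsOpen O ∧ p ∈ O ∧
          ((∀ m ∈ O, ∀ v ∈ D m, mvfderiv (𝓡 (2 * n + 1)) f m v = 0) ∨
            (∀ m ∈ O, ∀ v ∈ orth θ D m, mvfderiv (𝓡 (2 * n + 1)) f m v = 0))) ∧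
      (IsFirstIntegral D f ∨ IsFirstIntegral (orth θ D) f →
        IsIntermediateIntegral θ (goursatEquation θ D) f) ∧
      (PreconnectedSpace M → (∀ m, hamiltonianField θ f m ∉ D m ⊓ orth θ D m) →
        (IsIntermediateIntegral θ (goursatEquation θ D) f ↔
          (∀ m, hamiltonianField θ f m ∈ D m) ∨ (∀ m, hamiltonianField θ f m ∈ orth θ D m)) ∧
        (IsIntermediateIntegral θ (goursatEquation θ D) f ↔
          IsFirstIntegral D f ∨ IsFirstIntegral (orth θ D) f))) := by
  refine ⟨fun h => h.hamiltonianField_mem hθ hD hDC hf, fun hY => ?_⟩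
  have h12 : IsIntermediateIntegral θ (goursatEquation θ D) f ↔
      ∀ m, hamiltonianField θ f m ∈ D m ∨ hamiltonianField θ f m ∈ orth θ D m :=
    ⟨fun h => h.hamiltonianField_mem hθ hD hDC hf,
      isIntermediateIntegral_of_hamiltonianField_mem hθ hD hDC hf hY⟩
  have hO := fun m => hamiltonianField_mem_orth_iff (f := f) hθ hDC m
  have hI := fun m => hamiltonianField_mem_iff (f := f) hθ hDC m
  have h13 : IsIntermediateIntegral θ (goursatEquation θ D) f ↔
      ∀ m, (∀ v ∈ D m, mvfderiv (𝓡 (2 * n + 1)) f m v = 0) ∨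
        (∀ v ∈ orth θ D m, mvfderiv (𝓡 (2 * n + 1)) f m v = 0) := by
    rw [h12]
    refine forall_congr' fun m => ?_
    rw [hO m, hI m, or_comm]
  have hclA := isClosed_setOf_forall_mvfderiv_eq_zero hθ hD hf
  have hclB : IsClosed {m : M | ∀ v ∈ orth θ D m, mvfderiv (𝓡 (2 * n + 1)) f m v = 0} := by
    simp only [← hI]
    exact isClosed_setOf_hamiltonianField_mem hθ hD hf
  have hfirst : (IsFirstIntegral D f ∨ IsFirstIntegral (orth θ D) f) →
      IsIntermediateIntegral θ (goursatEquation θ D) f := fun h =>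
    h13.2 fun m => h.imp (fun h => h m) fun h => h m
  refine ⟨h12, h13, h13.trans ⟨fun h => ?_, ?_⟩, hfirst, fun hM hne => ?_⟩
  · refine ⟨_, dense_interior_union_interior hclA (Set.eq_univ_of_forall h), ?_⟩
    rintro p (hp | hp)
    · exact ⟨_, isOpen_interior, hp, Or.inl fun m hm => interior_subset hm⟩
    · exact ⟨_, isOpen_interior, hp, Or.inr fun m hm => interior_subset hm⟩
  · rintro ⟨U, hU, hUO⟩ m
    -- The union of the two closed sets contains a dense set, hence every point.
    refine (hclA.union hclB).closure_subset_iff.2 (fun p hp => ?_) (hU m)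
    obtain ⟨O, -, hpO, h⟩ := hUO p hp
    exact h.imp (fun h => h p hpO) fun h => h p hpO
  · have hsec : IsIntermediateIntegral θ (goursatEquation θ D) f ↔
        IsFirstIntegral D f ∨ IsFirstIntegral (orth θ D) f := by
      refine ⟨fun h => ?_, hfirst⟩
      have hcov := Set.eq_univ_of_forall (h13.1 h)
      -- The two closed sets cover `M`, and a common point would have `Y_f ∈ D ∩ D^⊥`. Each is
      -- therefore clopen, and connectedness leaves one of them empty.
      have hcompl : IsCompl {m : M | ∀ v ∈ D m, mvfderiv (𝓡 (2 * n + 1)) f m v = 0}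
          {m : M | ∀ v ∈ orth θ D m, mvfderiv (𝓡 (2 * n + 1)) f m v = 0} :=
        ⟨Set.disjoint_left.2 fun m h1 h2 => hne m ⟨(hI m).2 h2, (hO m).2 h1⟩,
          codisjoint_iff.2 hcov⟩
      have hclopen : IsClopen {m : M | ∀ v ∈ D m, mvfderiv (𝓡 (2 * n + 1)) f m v = 0} :=
        ⟨hclA, by rw [← isClosed_compl_iff, hcompl.compl_eq]; exact hclB⟩
      rcases isClopen_iff.1 hclopen with h0 | h0
      · refine Or.inr fun m => ((h13.1 h) m).resolve_left fun hm => ?_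
        exact Set.notMem_empty m (h0.subset hm)
      · exact Or.inl fun m => h0.superset (Set.mem_univ m)
    refine ⟨hsec.trans ?_, hsec⟩
    rw [or_comm]
    exact or_congr (forall_congr' fun m => (hI m).symm) (forall_congr' fun m => (hO m).symm)
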